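/- Let $(r_n)_{n\ge1}$ be real numbers with $0\le r_n<\frac23$, $r_n\downarrow0$ (non-increasing with limit $0$) and $r_n-r_{n+1}=O(r_n^2)$ as $n\to\infty$. Put $p_n=\frac13+r_n$, $q_n=1-p_n$ and $a_n=q_n/p_n$ for $n\ge1$. Let $X=(X_k)_{k\ge0}$ be a Markov chain on $\{0,1,2,\dots\}$, with an arbitrary initial distribution, such that $$P(X_{k+1}=n+2\mid X_k=n)=p_n,\quad P(X_{k+1}=n-1\mid X_k=n)=q_n\quad(n\ge1),\qquad P(X_{k+1}=2\mid X_k=0)=1.$$ A site $k\ge0$ is called a skipped point of $X$ if $X_n\ne k$ for all $n\ge0$. Let $(\xi_n)_{n\ge1}$ be the (unique) positive solution of $$\xi_n=\frac1{a_n}\Bigl(1+\frac1{\xi_{n+1}}\Bigr),\qquad n\ge1,$$ let $U_i=1/\xi_i$, and for $m\ge1$ let $$D(m)=\lim_{n\to\infty}\sum_{j=m+1}^{n}\ \prod_{i=m+1}^{j-1}U_i\in[1,\infty],$$ where the empty product equals $1$ and $1/\infty=0$. (i) If $\sum_{n=2}^\infty\frac{1}{D(n)\log n}<\infty$, then almost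 surely $X$ has at most finitely many skipped points. (ii) If there is $\delta>0$ such that $D(n)\le\delta n\log n$ for all sufficiently large $n$, and $\sum_{n=2}^\infty\frac1{D(n)\log n}=\infty$, then with probability at least $\frac{11}{27}$ the chain $X$ has infinitely many skipped points. -/

import Mathlib

open MeasureTheory Filter Topology
open scoped ENNReal

namespace SkipWalk

/-- One-step transition probabilities of the (1,2) random walk on `{0, 1, 2, ...}`: from `n ≥ 1` it
jumps to `n + 2` with probability `p n` and to `n - 1` with probability `1 - p n`; from `0` it
jumps to `2`. (The value `p 0` plays no role.) -/
noncomputable def trans (p : ℕ → ℝ) (n m : ℕ) : ℝ :=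
  if n = 0 then (if m = 2 then 1 else 0)
  else if m = n + 2 then p n
  else if m + 1 = n then 1 - p n
  else 0

/-- `X` is a Markov chain under `P` with transition matrix `trans p`, with arbitrary initial law:
`P(X₀ = x₀, ..., Xₖ₊₁ = xₖ₊₁) = P(X₀ = x₀, ..., Xₖ = xₖ) * trans p xₖ xₖ₊₁`. -/
structure IsWalk {Ω : Type*} [MeasurableSpace Ω] (P : Measure Ω) (p : ℕ → ℝ)
    (X : ℕ → Ω → ℕ) : Prop where
  measurable : ∀ k, Measurable (X k)
  markov : ∀ (k : ℕ) (x : ℕ → ℕ),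
    P {ω | ∀ i ≤ k + 1, X i ω = x i} =
      P {ω | ∀ i ≤ k, X i ω = x i} * ENNReal.ofReal (trans p (x k) (x (k + 1)))

/-- The set of skipped points of the trajectory `ω`: the sites that are never visited. -/
def skipped {Ω : Type*} (X : ℕ → Ω → ℕ) (ω : Ω) : Set ℕ :=
  {k | ∀ n, X n ω ≠ k}

/-- `a n = q n / p n`. -/
noncomputable def ratio (p : ℕ → ℝ) (n : ℕ) : ℝ := (1 - p n) / p n

/-- `ξ 1, ξ 2, ...` is a positive solution of `ξ n = (1 / a n) * (1 + 1 / ξ (n + 1))`, `n ≥ 1`. -/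
def IsTailSolution (p : ℕ → ℝ) (ξ : ℕ → ℝ) : Prop :=
  ∀ n, 1 ≤ n → 0 < ξ n ∧ ξ n = 1 / ratio p n * (1 + 1 / ξ (n + 1))

/-- `D(m, n) = ∑_{j = m+1}^{n} ∏_{i = m+1}^{j-1} U i` with `U i = 1 / ξ i`
(the empty product is `1`). -/
noncomputable def DFin (ξ : ℕ → ℝ) (m n : ℕ) : ℝ :=
  ∑ j ∈ Finset.Icc (m + 1) n, ∏ i ∈ Finset.Ico (m + 1) j, 1 / ξ i

/-- `D(m) = lim_n D(m, n)`, with values in `[0, ∞]`; the sequence is nondecreasing, so that its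
limit is its supremum (see `tendsto_DFin`). -/
noncomputable def D (ξ : ℕ → ℝ) (m : ℕ) : ℝ≥0∞ := ⨆ n, ENNReal.ofReal (DFin ξ m n)

theorem tendsto_DFin {p ξ : ℕ → ℝ} (h : IsTailSolution p ξ) (m : ℕ) :
    Tendsto (fun n => ENNReal.ofReal (DFin ξ m n)) atTop (𝓝 (D ξ m)) := by
  refine tendsto_atTop_iSup fun a b hab => ENNReal.ofReal_le_ofReal ?_
  refine Finset.sum_le_sum_of_subset_of_nonneg (Finset.Icc_subset_Icc_right hab) ?_
  intro j _ _
  refine Finset.prod_nonneg fun i hi => ?_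
  have := (h i (by have := (Finset.mem_Ico.1 hi).1; omega)).1
  positivity

/-- `∑_{n ≥ 2} 1 / (D(n) log n)`, with values in `[0, ∞]` (and `1 / ∞ = 0`). -/
noncomputable def critSum (ξ : ℕ → ℝ) : ℝ≥0∞ :=
  ∑' n : ℕ, 1 / (D ξ (n + 2) * ENNReal.ofReal (Real.log ((n + 2 : ℕ) : ℝ)))

end SkipWalk

/-! ### The harmonic functions `DFin ξ m`. -/

namespace SkipWalk

/-! Write U i for 1 / ξ i. The recursion for ξ says exactly that `DFin ξ m`, which vanishes on [0,
m] and equals 1 at m + 1, is harmonic above m (`DFin_harmonic`). Optional stopping then gives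
probability 1 / D(m) of never visiting m from m + 1 (`measure_escape`). Downward steps have size
one, so a point k above the start is skipped precisely when the first passage jumps from k - 1 to k
+ 1 and the path never comes back to k. Such a jump has probability at least 1/28 for large k, so
P(k skipped) is comparable to 1 / D(k). Given the jump, the path after it is independent of the path
before it (`measure_passThen_mul`). Since p is nonincreasing and at least 1/3, U ≤ 1 and hence D(l,
n) ≤ n - l.

(i) Skipped points cluster. If the last skipped point k of [0, 4a] lies in (2a, 4a], then, given
this, each l in (a, k - 4] is skipped with probability at least 1 / (784 (k + 1 - l)), so the
expected number of skipped points below k is at least of order log a. Therefore P(some point of (2a,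
4a] is skipped) · log a is at most a constant times the sum of 1 / D(l) over (a, 4a]
(`measure_skipBlock_mul_log_le`), and Borel–Cantelli along powers of 2 concludes.

(ii) Count skipped points with weights 1 / log k. For k < l, the bound 1 / (D(k, l) D(l)) for P(k
and l skipped) exceeds 1 / (D(k) D(l)) by a correction whose sum over l is at most 2 log D(k) /
D(k), hence at most 6 log k / D(k); the weights absorb this logarithm. The second moment is then at
most a constant times the squared first moment, so from every start there are infinitely many
skipped points with probability at least 1/3136. This holds conditionally on every finite past, and
Lévy's 0-1 law raises the probability to 1, which is more than 11/27.

Conditioning is carried out by restricting the measure, which is why the lemmas treat finite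
measures of arbitrary mass `P Set.univ`. -/

theorem IsTailSolution.eq_div {p ξ : ℕ → ℝ} (h : IsTailSolution p ξ) {n : ℕ} (hn : 1 ≤ n) :
    1 / ξ n = ratio p n / (1 + 1 / ξ (n + 1)) := by
  rw [(h n hn).2, one_div, mul_inv, one_div, inv_inv]
  rfl

theorem IsTailSolution.one_div_pos {p ξ : ℕ → ℝ} (h : IsTailSolution p ξ) {n : ℕ} (hn : 1 ≤ n) :
    0 < 1 / ξ n := _root_.one_div_pos.2 (h n hn).1

/-- If the ratios are positive, nondecreasing and bounded by `2`, then `1 / ξ n ≤ 1`. -/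
theorem IsTailSolution.one_div_le_one {p ξ : ℕ → ℝ} (h : IsTailSolution p ξ)
    (hpos : ∀ n, 1 ≤ n → 0 < ratio p n) (hmono : ∀ n, 1 ≤ n → ratio p n ≤ ratio p (n + 1))
    (hle : ∀ n, 1 ≤ n → ratio p n ≤ 2) {n : ℕ} (hn : 1 ≤ n) : 1 / ξ n ≤ 1 := by
  have key : ∀ k : ℕ, ∀ n, 1 ≤ n → 1 / ξ n ≤ 1 + (1 / 3 : ℝ) ^ k := by
    intro k
    induction k with
    | zero =>
      intro n hn
      rw [h.eq_div hn, div_le_iff₀ (by have := h.one_div_pos (n := n + 1) (by omega); linarith)]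
      have h1 := h.one_div_pos (n := n + 1) (by omega)
      have h2 := hle n hn
      rw [pow_zero]
      linarith
    | succ k ih =>
      intro n hn
      have u1 := h.one_div_pos (n := n + 1) (by omega)
      have u2 := h.one_div_pos (n := n + 2) (by omega)
      have i2 := ih (n + 2) (by omega)
      have e1 := h.eq_div (n := n + 1) (by omega)
      have e0 := h.eq_div hn
      have hp := hpos n hn
      have hm := hmono n hn
      have hl := hle n hn
      have ht : (0 : ℝ) < (1 / 3) ^ k := by positivity
      rw [pow_succ]
      set t : ℝ := (1 / 3) ^ k
      rw [show n + 1 + 1 = n + 2 from rfl] at e1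
      set a := ratio p n
      set b := ratio p (n + 1)
      set u := 1 / ξ (n + 1)
      set v := 1 / ξ (n + 2)
      rw [e0, div_le_iff₀ (by linarith)]
      -- The map u ↦ a / (1 + u) is decreasing, so two iterations are needed: the upper bound 1 + t
      -- at n + 2 gives this lower bound at n + 1, which gives an upper bound at n. The excess over
      -- 1 contracts by a factor 1/3.
      have hu : a / (2 + t) ≤ u := by
        rw [e1]
        exact div_le_div₀ (by linarith) hm (by linarith) (by linarith)
      have h2 : a ≤ u * (2 + t) := by rwa [div_le_iff₀ (by linarith)] at hu
      have h3 : (1 + t * (1 / 3)) * (1 + a / (2 + t)) ≤ (1 + t * (1 / 3)) * (1 + u) := by gcongr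
      refine le_trans ?_ h3
      have h4 : (1 + t * (1 / 3)) * (1 + a / (2 + t)) - a =
        (1 + t * (1 / 3)) - a * (1 + t * (2 / 3)) / (2 + t) := by
        field_simp; ring
      have h5 : a * (1 + t * (2 / 3)) / (2 + t) ≤ 1 + t * (1 / 3) := by
        rw [div_le_iff₀ (by linarith)]
        nlinarith
      linarith
  have hlim : Tendsto (fun k : ℕ => 1 + (1 / 3 : ℝ) ^ k) atTop (𝓝 (1 + 0)) :=
    tendsto_const_nhds.add (tendsto_pow_atTop_nhds_zero_of_lt_one (by norm_num) (by norm_num))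
  rw [add_zero] at hlim
  exact ge_of_tendsto' hlim fun k => key k n hn

theorem DFin_of_le (ξ : ℕ → ℝ) {m n : ℕ} (h : n ≤ m) : DFin ξ m n = 0 := by
  rw [DFin, Finset.Icc_eq_empty (by omega), Finset.sum_empty]

theorem DFin_succ (ξ : ℕ → ℝ) {m n : ℕ} (h : m ≤ n) :
    DFin ξ m (n + 1) = DFin ξ m n + ∏ i ∈ Finset.Ico (m + 1) (n + 1), 1 / ξ i := by
  rw [DFin, DFin, Finset.sum_Icc_succ_top (by omega)]

theorem DFin_self_succ (ξ : ℕ → ℝ) (m : ℕ) : DFin ξ m (m + 1) = 1 := by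
  rw [DFin_succ ξ le_rfl, DFin_of_le ξ le_rfl]; simp

theorem IsTailSolution.prod_pos {p ξ : ℕ → ℝ} (h : IsTailSolution p ξ) (m n : ℕ) :
    0 < ∏ i ∈ Finset.Ico (m + 1) n, 1 / ξ i :=
  Finset.prod_pos fun i hi => h.one_div_pos (by have := (Finset.mem_Ico.1 hi).1; omega)

theorem IsTailSolution.DFin_mono {p ξ : ℕ → ℝ} (h : IsTailSolution p ξ) (m : ℕ) :
    Monotone (DFin ξ m) := by
  refine monotone_nat_of_le_succ fun n => ?_
  rcases le_or_gt m n with hn | hn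
  · rw [DFin_succ ξ hn]; linarith [h.prod_pos m (n + 1)]
  · rw [DFin_of_le ξ hn.le, DFin_of_le ξ (by omega)]

theorem IsTailSolution.one_le_DFin {p ξ : ℕ → ℝ} (h : IsTailSolution p ξ) {m n : ℕ} (hmn : m < n) :
    1 ≤ DFin ξ m n := by
  rw [← DFin_self_succ ξ m]
  exact h.DFin_mono m hmn

theorem IsTailSolution.DFin_nonneg {p ξ : ℕ → ℝ} (h : IsTailSolution p ξ) (m n : ℕ) :
    0 ≤ DFin ξ m n := by
  rcases le_or_gt n m with hn | hn
  · rw [DFin_of_le ξ hn]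
  · linarith [h.one_le_DFin hn]

/-- `DFin ξ m` is harmonic on `(m, ∞)` for the walk. -/
theorem IsTailSolution.DFin_harmonic {p ξ : ℕ → ℝ} (h : IsTailSolution p ξ)
    {m n : ℕ} (hp : p (n + 1) ≠ 0) (hmn : m ≤ n) :
    p (n + 1) * DFin ξ m (n + 3) + (1 - p (n + 1)) * DFin ξ m n = DFin ξ m (n + 1) := by
  rw [DFin_succ ξ (show m ≤ n + 2 by omega), DFin_succ ξ (show m ≤ n + 1 by omega),
    DFin_succ ξ hmn, Finset.prod_Ico_succ_top (show m + 1 ≤ n + 2 by omega),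
    Finset.prod_Ico_succ_top (show m + 1 ≤ n + 1 by omega)]
  have e := h.eq_div (n := n + 1) (by omega)
  have u := h.one_div_pos (n := n + 2) (by omega)
  rw [show n + 1 + 1 = n + 2 from rfl, eq_div_iff (by linarith), ratio, eq_div_iff hp] at e
  -- With π the product in front, the successive increments of `DFin ξ m` from n to n + 3 are π, π U
  -- (n + 1) and π U (n + 1) U (n + 2); harmonicity is p U (n + 1) (1 + U (n + 2)) = 1 - p.
  linear_combination (∏ i ∈ Finset.Ico (m + 1) (n + 1), 1 / ξ i) * e

theorem DFin_add (ξ : ℕ → ℝ) {k l n : ℕ} (hkl : k ≤ l) (hln : l ≤ n) :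
    DFin ξ k n = DFin ξ k l + (∏ i ∈ Finset.Ico (k + 1) (l + 1), 1 / ξ i) * DFin ξ l n := by
  induction n, hln using Nat.le_induction with
  | base => rw [DFin_of_le ξ le_rfl, mul_zero, add_zero]
  | succ n hn ih =>
    rw [DFin_succ ξ (hkl.trans hn), DFin_succ ξ hn, ih, mul_add,
      Finset.prod_Ico_consecutive _ (by omega) (by omega)]
    ring

theorem IsTailSolution.prod_le_one {p ξ : ℕ → ℝ} (h : IsTailSolution p ξ)
    (hle : ∀ n, 1 ≤ n → 1 / ξ n ≤ 1) (m n : ℕ) :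
    ∏ i ∈ Finset.Ico (m + 1) n, 1 / ξ i ≤ 1 := by
  refine Finset.prod_le_one (fun i hi => (h.one_div_pos ?_).le) (fun i hi => hle i ?_) <;>
  · have := (Finset.mem_Ico.1 hi).1
    omega

theorem IsTailSolution.DFin_le_sub {p ξ : ℕ → ℝ} (h : IsTailSolution p ξ)
    (hle : ∀ n, 1 ≤ n → 1 / ξ n ≤ 1) {m n : ℕ} (hmn : m ≤ n) : DFin ξ m n ≤ n - m := by
  induction n, hmn using Nat.le_induction with
  | base => rw [DFin_of_le ξ le_rfl, sub_self]
  | succ n hn ih =>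
    rw [DFin_succ ξ hn]
    have := h.prod_le_one hle m (n + 1)
    push_cast
    linarith

theorem DFin_le_D (ξ : ℕ → ℝ) (m n : ℕ) :
    ENNReal.ofReal (DFin ξ m n) ≤ D ξ m := le_iSup (fun n => ENNReal.ofReal (DFin ξ m n)) n

theorem one_le_D (ξ : ℕ → ℝ) (m : ℕ) : 1 ≤ D ξ m := by
  have := DFin_le_D ξ m (m + 1)
  rwa [DFin_self_succ, ENNReal.ofReal_one] at this

/-- `D(k) = D(k, l) + (∏_{i = k+1}^{l} 1 / ξ i) D(l)`. -/
theorem IsTailSolution.D_add {p ξ : ℕ → ℝ} (h : IsTailSolution p ξ) {k l : ℕ} (hkl : k ≤ l)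
    (hk : D ξ k ≠ ∞) (hl : D ξ l ≠ ∞) :
    (D ξ k).toReal = DFin ξ k l +
      (∏ i ∈ Finset.Ico (k + 1) (l + 1), 1 / ξ i) * (D ξ l).toReal := by
  have t : ∀ m, D ξ m ≠ ∞ → Tendsto (fun n => DFin ξ m n) atTop (𝓝 (D ξ m).toReal) := by
    intro m hm
    refine ((ENNReal.tendsto_toReal hm).comp (tendsto_DFin h m)).congr fun n => ?_
    exact ENNReal.toReal_ofReal (h.DFin_nonneg m n)
  refine tendsto_nhds_unique (t k hk) ?_
  refine (tendsto_const_nhds.add ((t l hl).const_mul _)).congr' ?_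
  filter_upwards [eventually_ge_atTop l] with n hn
  rw [DFin_add ξ hkl hn]

end SkipWalk

/-! ### Markov property and uniqueness of the law. -/

namespace SkipWalk

/-- The event `C` is determined by `X 0, ..., X t`. -/
def Past {Ω : Type*} (X : ℕ → Ω → ℕ) (t : ℕ) (C : Set Ω) : Prop :=
  ∀ ⦃ω ω' : Ω⦄, (∀ i ≤ t, X i ω = X i ω') → ω ∈ C → ω' ∈ C

theorem Past.inter {Ω : Type*} {X : ℕ → Ω → ℕ} {t : ℕ} {C C' : Set Ω}
    (h : Past X t C) (h' : Past X t C') : Past X t (C ∩ C') := fun _ _ e hω => ⟨h e hω.1, h' e hω.2⟩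

theorem Past.mono {Ω : Type*} {X : ℕ → Ω → ℕ} {s t : ℕ} {C : Set Ω} (h : Past X s C) (hst : s ≤ t) :
    Past X t C := fun _ _ e hω => h (fun i hi => e i (hi.trans hst)) hω

theorem past_forall {Ω : Type*} (X : ℕ → Ω → ℕ) (t : ℕ) (B : ℕ → Set ℕ) :
    Past X t {ω | ∀ s ≤ t, X s ω ∈ B s} := fun _ _ e hω s hs => e s hs ▸ hω s hs

theorem past_preimage {Ω : Type*} (X : ℕ → Ω → ℕ) {s t : ℕ} (hst : s ≤ t) (B : Set ℕ) :
    Past X t {ω | X s ω ∈ B} := fun ω ω' e (hω : X s ω ∈ B) =>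
  show X s ω' ∈ B from e s hst ▸ hω

/-- The first `t + 1` coordinates. -/
def initial {Ω : Type*} (X : ℕ → Ω → ℕ) (t : ℕ) (ω : Ω) : Fin (t + 1) → ℕ := fun i => X i ω

variable {Ω : Type*} [MeasurableSpace Ω]

theorem measure_eq_tsum_fiber {ι : Type*} [Countable ι] (P : Measure Ω) (g : Ω → ι)
    (hg : ∀ i, MeasurableSet (g ⁻¹' {i})) (S : Set Ω) :
    P S = ∑' i, P (S ∩ g ⁻¹' {i}) := by
  have h1 : ∀ i, P (S ∩ g ⁻¹' {i}) = (P.restrict S) (g ⁻¹' {i}) := fun i => by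
    rw [Measure.restrict_apply (hg i), Set.inter_comm]
  simp_rw [h1]
  rw [← measure_iUnion (fun i j hij => Disjoint.preimage g (by simpa using hij)) hg,
    ← Set.preimage_iUnion, Set.iUnion_of_singleton, Set.preimage_univ, Measure.restrict_apply_univ]

theorem measurableSet_initial {X : ℕ → Ω → ℕ} (hX : ∀ k, Measurable (X k)) (t : ℕ)
    (y : Fin (t + 1) → ℕ) : MeasurableSet (initial X t ⁻¹' {y}) :=
  (measurable_pi_lambda _ fun i : Fin (t + 1) => hX i) (measurableSet_singleton y)

theorem Past.measurableSet {X : ℕ → Ω → ℕ} (hX : ∀ k, Measurable (X k)) {t : ℕ} {C : Set Ω}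
    (h : Past X t C) : MeasurableSet C := by
  have : C = ⋃ y ∈ initial X t '' C, initial X t ⁻¹' {y} := by
    ext ω
    simp only [Set.mem_iUnion, exists_prop]
    constructor
    · exact fun hω => ⟨_, ⟨ω, hω, rfl⟩, rfl⟩
    · rintro ⟨_, ⟨ω', hω', rfl⟩, hω⟩
      refine h (fun i hi => ?_) hω'
      exact (congrFun (show initial X t ω = initial X t ω' from hω) ⟨i, by omega⟩).symm
  rw [this]
  exact MeasurableSet.biUnion (Set.to_countable _) fun y _ => measurableSet_initial hX t y

/-- Splitting along the first t + 1 coordinates, an event of the past is a countable union of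
cylinders, and on each of them this is the defining property of the walk. -/
theorem IsWalk.measure_step {P : Measure Ω} {p : ℕ → ℝ} {X : ℕ → Ω → ℕ} (hX : IsWalk P p X)
    {t : ℕ} {C : Set Ω} (hC : Past X t C) {a : ℕ} (ha : ∀ ω ∈ C, X t ω = a) (b : ℕ) :
    P (C ∩ {ω | X (t + 1) ω = b}) = P C * ENNReal.ofReal (trans p a b) := by
  rw [measure_eq_tsum_fiber P (initial X t) (measurableSet_initial hX.measurable t),
    measure_eq_tsum_fiber P (initial X t) (measurableSet_initial hX.measurable t) C,
    ← ENNReal.tsum_mul_right]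
  refine tsum_congr fun y => ?_
  by_cases hne : ∃ ω ∈ C, initial X t ω = y
  · obtain ⟨ω₀, hω₀, rfl⟩ := hne
    set x : ℕ → ℕ := fun i => if i ≤ t then X i ω₀ else b with hx
    have hsub : ∀ ω, (∀ i ≤ t, X i ω = x i) ↔ initial X t ω = initial X t ω₀ := by
      intro ω
      constructor
      · intro h
        funext i
        have := h i (by omega)
        simpa [hx, initial, show (i : ℕ) ≤ t by omega] using this
      · intro h i hi
        have := congrFun h ⟨i, by omega⟩
        simpa [hx, initial, hi] using this
    have hC' : ∀ ω, initial X t ω = initial X t ω₀ → ω ∈ C := fun ω h =>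
      hC (fun i hi => (congrFun h ⟨i, by omega⟩).symm) hω₀
    have e1 : C ∩ {ω | X (t + 1) ω = b} ∩ initial X t ⁻¹' {initial X t ω₀} =
        {ω | ∀ i ≤ t + 1, X i ω = x i} := by
      ext ω
      simp only [Set.mem_inter_iff, Set.mem_ofPred_eq, Set.mem_preimage, Set.mem_singleton_iff]
      constructor
      · rintro ⟨⟨_, h1⟩, h2⟩ i hi
        rcases Nat.lt_or_ge t i with h | h
        · obtain rfl : i = t + 1 := by omega
          simpa [hx] using h1
        · exact (hsub ω).2 h2 i h
      · intro h
        have h2 := (hsub ω).1 fun i hi => h i (by omega)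
        refine ⟨⟨hC' ω h2, ?_⟩, h2⟩
        simpa [hx] using h (t + 1) le_rfl
    have e2 : C ∩ initial X t ⁻¹' {initial X t ω₀} = {ω | ∀ i ≤ t, X i ω = x i} := by
      ext ω
      simp only [Set.mem_inter_iff, Set.mem_ofPred_eq, Set.mem_preimage, Set.mem_singleton_iff, hsub]
      exact ⟨fun h => h.2, fun h => ⟨hC' ω h, h⟩⟩
    rw [e1, e2, hX.markov]
    simp [hx, ha ω₀ hω₀]
  · have e : C ∩ initial X t ⁻¹' {y} = ∅ := by
      ext ω
      simp only [Set.mem_inter_iff, Set.mem_preimage, Set.mem_singleton_iff, Set.mem_empty_iff_false,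
        iff_false, not_and]
      exact fun h h' => hne ⟨ω, h, h'⟩
    have e' : C ∩ {ω | X (t + 1) ω = b} ∩ initial X t ⁻¹' {y} = ∅ := by
      rw [Set.inter_right_comm, e, Set.empty_inter]
    rw [e, e', measure_empty, zero_mul]

/-- The transition operator. -/
noncomputable def avg (p : ℕ → ℝ) (f : ℕ → ℝ≥0∞) (n : ℕ) : ℝ≥0∞ :=
  ∑' m, ENNReal.ofReal (trans p n m) * f m

theorem avg_zero (p : ℕ → ℝ) (f : ℕ → ℝ≥0∞) : avg p f 0 = f 2 := by
  rw [avg, tsum_eq_single 2]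
  · simp [trans]
  · intro m hm
    simp [trans, hm]

theorem avg_succ (p : ℕ → ℝ) (f : ℕ → ℝ≥0∞) (n : ℕ) :
    avg p f (n + 1) =
      ENNReal.ofReal (p (n + 1)) * f (n + 3) + ENNReal.ofReal (1 - p (n + 1)) * f n := by
  rw [avg, tsum_eq_sum (s := {n + 3, n})]
  · rw [Finset.sum_pair (by omega)]
    simp [trans, show n ≠ n + 1 + 2 by omega]
  · intro m hm
    simp only [Finset.mem_insert, Finset.mem_singleton, not_or] at hm
    simp [trans, hm]

theorem lintegral_eq_tsum_fiber (P : Measure Ω) {Y : Ω → ℕ} (hY : Measurable Y) (f : ℕ → ℝ≥0∞)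
    (C : Set Ω) : ∫⁻ ω in C, f (Y ω) ∂P = ∑' b, f b * P (C ∩ {ω | Y ω = b}) := by
  rw [← lintegral_map (f := f) (Measurable.of_discrete) hY, lintegral_countable']
  refine tsum_congr fun b => ?_
  rw [Measure.map_apply hY (measurableSet_singleton b),
    Measure.restrict_apply (hY (measurableSet_singleton b)), Set.inter_comm]
  rfl

theorem IsWalk.lintegral_step {P : Measure Ω} {p : ℕ → ℝ} {X : ℕ → Ω → ℕ} (hX : IsWalk P p X)
    {t : ℕ} {C : Set Ω} (hC : Past X t C) (f : ℕ → ℝ≥0∞) :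
    ∫⁻ ω in C, f (X (t + 1) ω) ∂P = ∫⁻ ω in C, avg p f (X t ω) ∂P := by
  rw [lintegral_eq_tsum_fiber P (hX.measurable _), lintegral_eq_tsum_fiber P (hX.measurable _)]
  have key : ∀ b, P (C ∩ {ω | X (t + 1) ω = b}) =
      ∑' a, P (C ∩ {ω | X t ω = a}) * ENNReal.ofReal (trans p a b) := by
    intro b
    rw [measure_eq_tsum_fiber P (X t) (fun i => hX.measurable t (measurableSet_singleton i))]
    refine tsum_congr fun a => ?_
    rw [Set.inter_right_comm]
    exact hX.measure_step (hC.inter (past_preimage X le_rfl {a})) (fun ω h => h.2) b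
  simp_rw [key, avg, ← ENNReal.tsum_mul_left, ← ENNReal.tsum_mul_right]
  rw [ENNReal.tsum_comm]
  refine tsum_congr fun a => tsum_congr fun b => ?_
  ring

/-- The substitute for conditioning: restricting to an event of the past yields a walk again, of
mass `P C`. -/
theorem IsWalk.shift {P : Measure Ω} {p : ℕ → ℝ} {X : ℕ → Ω → ℕ} (hX : IsWalk P p X)
    {t : ℕ} {C : Set Ω} (hC : Past X t C) : IsWalk (P.restrict C) p (fun i => X (t + i)) where
  measurable k := hX.measurable _
  markov k x := by
    have hm : ∀ k, MeasurableSet {ω | ∀ i ≤ k, X (t + i) ω = x i} := fun k => by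
      have : {ω | ∀ i ≤ k, X (t + i) ω = x i} = ⋂ i ∈ Set.Iic k, {ω | X (t + i) ω = x i} := by
        ext; simp
      rw [this]
      exact MeasurableSet.biInter (Set.to_countable _) fun i _ =>
        hX.measurable _ (measurableSet_singleton _)
    rw [Measure.restrict_apply (hm _), Measure.restrict_apply (hm _)]
    have hp : Past X (t + k) ({ω | ∀ i ≤ k, X (t + i) ω = x i} ∩ C) := by
      rintro ω ω' e ⟨h1, h2⟩
      exact ⟨fun i hi => (e (t + i) (by omega)).symm.trans (h1 i hi),
        hC (fun i hi => e i (by omega)) h2⟩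
    rw [← hX.measure_step hp (fun ω h => h.1 k le_rfl)]
    congr 1
    ext ω
    constructor
    · rintro ⟨h1, h2⟩
      exact ⟨⟨fun i hi => h1 i (by omega), h2⟩, h1 (k + 1) le_rfl⟩
    · rintro ⟨⟨h1, h2⟩, h3⟩
      refine ⟨fun i hi => ?_, h2⟩
      rcases Nat.lt_or_ge k i with h | h
      · obtain rfl : i = k + 1 := by omega
        exact h3
      · exact h1 i h

/-- The trajectory makes only steps `+2` and `-1`. -/
def Legal (x : ℕ → ℕ) : Prop := ∀ t, x (t + 1) = x t + 2 ∨ x (t + 1) + 1 = x t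

theorem IsWalk.ae_legal {P : Measure Ω} {p : ℕ → ℝ} {X : ℕ → Ω → ℕ} (hX : IsWalk P p X) :
    ∀ᵐ ω ∂P, Legal (fun t => X t ω) := by
  refine ae_all_iff.2 fun t => ?_
  have : ∀ a b : ℕ, ¬ (b = a + 2 ∨ b + 1 = a) → ∀ᵐ ω ∂P, ¬ (X t ω = a ∧ X (t + 1) ω = b) := by
    intro a b hab
    rw [ae_iff]
    have h := hX.measure_step (past_preimage X (le_refl t) {a}) (fun ω h => h) b
    have h0 : trans p a b = 0 := by
      rw [trans]
      split_ifs <;> first | rfl | omega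
    rw [h0, ENNReal.ofReal_zero, mul_zero] at h
    refine measure_mono_null ?_ h
    intro ω hω
    simp only [not_not, Set.mem_ofPred_eq] at hω
    exact hω
  have h2 : ∀ᵐ ω ∂P, ∀ a b : ℕ, ¬ (b = a + 2 ∨ b + 1 = a) → ¬ (X t ω = a ∧ X (t + 1) ω = b) := by
    refine ae_all_iff.2 fun a => ae_all_iff.2 fun b => ?_
    by_cases hab : (b = a + 2 ∨ b + 1 = a)
    · simp [hab]
    · filter_upwards [this a b hab] with ω hω _ using hω
  filter_upwards [h2] with ω hω
  by_contra hne
  exact hω _ _ hne ⟨rfl, rfl⟩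

theorem IsWalk.measure_prefix {P : Measure Ω} {p : ℕ → ℝ} {X : ℕ → Ω → ℕ} (hX : IsWalk P p X)
    {a : ℕ} (ha : ∀ᵐ ω ∂P, X 0 ω = a) (k : ℕ) (x : ℕ → ℕ) :
    P {ω | ∀ i ≤ k, X i ω = x i} =
      P Set.univ * ((if x 0 = a then 1 else 0) *
        ∏ i ∈ Finset.range k, ENNReal.ofReal (trans p (x i) (x (i + 1)))) := by
  induction k with
  | zero =>
    simp only [Nat.le_zero, forall_eq, Finset.range_zero, Finset.prod_empty, mul_one]
    split_ifs with h
    · rw [mul_one]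
      refine measure_congr ?_
      filter_upwards [ha] with ω hω
      exact propext ⟨fun _ => trivial, fun _ => hω.trans h.symm⟩
    · rw [mul_zero]
      refine measure_mono_null (fun ω hω => ?_) (ae_iff.1 ha)
      exact fun h' => h (Eq.trans (Eq.symm hω) h')
  | succ k ih =>
    rw [hX.markov, ih, Finset.prod_range_succ]
    ring

theorem pi_eq_generateFrom_prefix :
    (MeasurableSpace.pi : MeasurableSpace (ℕ → ℕ)) =
      MeasurableSpace.generateFrom {S | ∃ (k : ℕ) (x : ℕ → ℕ), S = {y | ∀ i ≤ k, y i = x i}} := by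
  apply le_antisymm
  · refine iSup_le fun n => ?_
    rw [← measurable_iff_comap_le]
    refine @measurable_to_countable' _ _ _ _ (_) _ fun a => ?_
    have : (fun y : ℕ → ℕ => y n) ⁻¹' {a} =
        ⋃ z ∈ {z : Fin (n + 1) → ℕ | z (Fin.last n) = a},
          {y : ℕ → ℕ | ∀ i ≤ n, y i = if h : i < n + 1 then z ⟨i, h⟩ else 0} := by
      ext y
      simp only [Set.mem_preimage, Set.mem_singleton_iff, Set.mem_iUnion, Set.mem_ofPred_eq,
        exists_prop]
      constructor
      · intro h
        refine ⟨fun i => y i, by simpa using h, fun i hi => ?_⟩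
        rw [dif_pos (by omega)]
      · rintro ⟨z, hz, h⟩
        rw [h n le_rfl, dif_pos (by omega), ← hz]
        rfl
    rw [this]
    exact MeasurableSet.biUnion (Set.to_countable _) fun z _ =>
      MeasurableSpace.measurableSet_generateFrom ⟨n, _, rfl⟩
  · refine MeasurableSpace.generateFrom_le ?_
    rintro _ ⟨k, x, rfl⟩
    have : {y : ℕ → ℕ | ∀ i ≤ k, y i = x i} = ⋂ i ∈ Set.Iic k, {y | y i = x i} := by
      ext; simp
    rw [this]
    exact MeasurableSet.biInter (Set.to_countable _) fun i _ =>
      measurable_pi_apply i (measurableSet_singleton _)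

theorem isPiSystem_prefix :
    IsPiSystem {S : Set (ℕ → ℕ) | ∃ (k : ℕ) (x : ℕ → ℕ), S = {y | ∀ i ≤ k, y i = x i}} := by
  rintro _ ⟨k, x, rfl⟩ _ ⟨l, x', rfl⟩ ⟨y, hy, hy'⟩
  refine ⟨max k l, y, ?_⟩
  ext z
  simp only [Set.mem_inter_iff, Set.mem_ofPred_eq] at *
  constructor
  · rintro ⟨h, h'⟩ i hi
    rcases le_max_iff.1 hi with hk | hl
    · rw [h i hk, hy i hk]
    · rw [h' i hl, hy' i hl]
  · intro h
    exact ⟨fun i hi => (h i (le_max_of_le_left hi)).trans (hy i hi),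
      fun i hi => (h i (le_max_of_le_right hi)).trans (hy' i hi)⟩

/-- The law of the walk is determined by its initial point, up to the total mass. -/
theorem IsWalk.law_unique {μ ν : Measure Ω} [IsFiniteMeasure μ] [IsFiniteMeasure ν]
    {p : ℕ → ℝ} {X Y : ℕ → Ω → ℕ} (hX : IsWalk μ p X) (hY : IsWalk ν p Y) {a : ℕ}
    (hXa : ∀ᵐ ω ∂μ, X 0 ω = a) (hYa : ∀ᵐ ω ∂ν, Y 0 ω = a) {S : Set (ℕ → ℕ)}
    (hS : MeasurableSet S) :
    ν Set.univ * μ {ω | (fun i => X i ω) ∈ S} = μ Set.univ * ν {ω | (fun i => Y i ω) ∈ S} := by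
  have mX : Measurable (fun ω i => X i ω) := measurable_pi_lambda _ hX.measurable
  have mY : Measurable (fun ω i => Y i ω) := measurable_pi_lambda _ hY.measurable
  -- Each law is multiplied by the mass of the other measure, so that nothing is divided by a mass
  -- that may be zero.
  have key : (ν Set.univ) • μ.map (fun ω i => X i ω) = (μ Set.univ) • ν.map (fun ω i => Y i ω) := by
    have : IsFiniteMeasure ((ν Set.univ) • μ.map (fun ω i => X i ω)) :=
      Measure.smul_finite _ (measure_ne_top _ _)
    refine ext_of_generate_finite _ pi_eq_generateFrom_prefix isPiSystem_prefix ?_ ?_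
    · rintro S ⟨k, x, rfl⟩
      have hS : MeasurableSet {y : ℕ → ℕ | ∀ i ≤ k, y i = x i} := by
        rw [pi_eq_generateFrom_prefix]
        exact MeasurableSpace.measurableSet_generateFrom ⟨k, x, rfl⟩
      rw [Measure.smul_apply, Measure.smul_apply, Measure.map_apply mX hS, Measure.map_apply mY hS]
      change _ * μ {ω | ∀ i ≤ k, X i ω = x i} = _ * ν {ω | ∀ i ≤ k, Y i ω = x i}
      rw [hX.measure_prefix hXa, hY.measure_prefix hYa]
      ring
    · rw [Measure.smul_apply, Measure.smul_apply, Measure.map_apply mX .univ,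
        Measure.map_apply mY .univ]
      exact mul_comm _ _
  have := congrArg (fun m => m S) key
  rwa [Measure.smul_apply, Measure.smul_apply, Measure.map_apply mX hS, Measure.map_apply mY hS]
    at this

end SkipWalk

/-! ### Unboundedness of the walk and gambler's ruin. -/

namespace SkipWalk

section Paths

/-- Downward steps have size one, so a path above m cannot get below m without visiting m. -/
theorem Legal.lt_of_ne {x : ℕ → ℕ} (hx : Legal x) {m s : ℕ} (hs : m < x s)
    {t : ℕ} (hst : s ≤ t) (hne : ∀ i, s ≤ i → i ≤ t → x i ≠ m) : m < x t := by
  induction t, hst using Nat.le_induction with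
  | base => exact hs
  | succ t ht ih =>
    have := ih fun i h1 h2 => hne i h1 (by omega)
    have := hne (t + 1) (by omega) le_rfl
    have := hx t
    omega

/-- The first passage over `n`. -/
theorem exists_first_passage {x : ℕ → ℕ} {n : ℕ} (h0 : x 0 < n) {s : ℕ} (hs : n ≤ x s) :
    ∃ t < s, (∀ i ≤ t, x i < n) ∧ n ≤ x (t + 1) := by
  classical
  have hex : ∃ s, n ≤ x s := ⟨s, hs⟩
  have hpos : Nat.find hex ≠ 0 := fun h => by
    have := Nat.find_spec hex
    rw [h] at this
    omega
  have hle := Nat.find_min' hex hs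
  refine ⟨Nat.find hex - 1, by omega, fun i hi => not_le.1 (Nat.find_min hex (by omega)), ?_⟩
  rw [Nat.sub_add_cancel (by omega)]
  exact Nat.find_spec hex

end Paths

/-- The walk is in `B` up to time `t`. -/
def stay {Ω : Type*} (X : ℕ → Ω → ℕ) (B : Set ℕ) (t : ℕ) : Set Ω := {ω | ∀ s ≤ t, X s ω ∈ B}

/-- The walk stays in `(m, n)` up to time `t`, and is in `[n, ∞)` at time `t + 1`. -/
def reach {Ω : Type*} (X : ℕ → Ω → ℕ) (m n t : ℕ) : Set Ω :=
  stay X (Set.Ioo m n) t ∩ {ω | n ≤ X (t + 1) ω}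

theorem past_stay {Ω : Type*} (X : ℕ → Ω → ℕ) (B : Set ℕ) (t : ℕ) : Past X t (stay X B t) :=
  past_forall X t fun _ => B

theorem past_reach {Ω : Type*} (X : ℕ → Ω → ℕ) (m n t : ℕ) : Past X (t + 1) (reach X m n t) :=
  ((past_stay X _ t).mono t.le_succ).inter (past_preimage X le_rfl (Set.Ici n))

theorem stay_succ {Ω : Type*} (X : ℕ → Ω → ℕ) (B : Set ℕ) (t : ℕ) :
    stay X B (t + 1) = {ω | X (t + 1) ω ∈ B} ∩ stay X B t := by
  ext ω
  constructor
  · exact fun h => ⟨h _ le_rfl, fun s hs => h s (by omega)⟩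
  · rintro ⟨h1, h2⟩ s hs
    rcases Nat.lt_or_ge t s with h | h
    · obtain rfl : s = t + 1 := by omega
      exact h1
    · exact h2 s h

theorem reach_disjoint {Ω : Type*} (X : ℕ → Ω → ℕ) (m n : ℕ) :
    Pairwise (Function.onFun Disjoint (reach X m n)) := by
  have key : ∀ s t, s < t → Disjoint (reach X m n s) (reach X m n t) := by
    intro s t hst
    rw [Set.disjoint_left]
    rintro ω ⟨_, h1⟩ ⟨h2, _⟩
    exact absurd (h2 (s + 1) (by omega)).2 (not_lt.2 h1)
  intro s t hst
  rcases lt_or_gt_of_ne hst with h | h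
  · exact key s t h
  · exact (key t s h).symm

variable {Ω : Type*} [MeasurableSpace Ω]

section Unbounded

/-- A bounded function that decreases by at least `1` on average on `[0, n)`. -/
noncomputable def lyapunov (n x : ℕ) : ℝ≥0∞ := ENNReal.ofReal (4 ^ (n + 2) - 4 ^ x)

/-- The drift 3 p - 1 at a positive site may vanish, so a linear function would not do; the convex
function 4 ^ x grows on average by at least 1. From below n the walk reaches at most n + 1, so the
exponent n + 2 keeps `ofReal` from truncating. -/
theorem avg_lyapunov {p : ℕ → ℝ} (hp : ∀ n, 1 ≤ n → 1 / 3 ≤ p n ∧ p n < 1) {n x : ℕ} (hx : x < n) :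
    avg p (lyapunov n) x + 1 ≤ lyapunov n x := by
  rcases x with _ | y
  · have h : (4 : ℝ) ^ 3 ≤ 4 ^ (n + 2) := pow_le_pow_right₀ (by norm_num) (by omega)
    rw [avg_zero, lyapunov, lyapunov, ← ENNReal.ofReal_one,
      ← ENNReal.ofReal_add (by norm_num at h ⊢; linarith) zero_le_one]
    exact ENNReal.ofReal_le_ofReal (by norm_num; linarith)
  · have hpy := hp (y + 1) (by omega)
    have h1 : (4 : ℝ) ^ (y + 3) ≤ 4 ^ (n + 2) := pow_le_pow_right₀ (by norm_num) (by omega)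
    have h2 : (4 : ℝ) ^ y ≤ 4 ^ (n + 2) := pow_le_pow_right₀ (by norm_num) (by omega)
    have h3 : (1 : ℝ) ≤ 4 ^ y := one_le_pow₀ (by norm_num)
    rw [avg_succ, lyapunov, lyapunov, lyapunov, ← ENNReal.ofReal_mul (by linarith),
      ← ENNReal.ofReal_mul (by linarith), ← ENNReal.ofReal_add
        (mul_nonneg (by linarith) (by linarith)) (mul_nonneg (by linarith) (by linarith)),
      ← ENNReal.ofReal_one, ← ENNReal.ofReal_add
        (add_nonneg (mul_nonneg (by linarith) (by linarith)) (mul_nonneg (by linarith)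
          (by linarith))) zero_le_one]
    refine ENNReal.ofReal_le_ofReal ?_
    rw [show (4 : ℝ) ^ (y + 3) = 64 * 4 ^ y by ring, pow_succ 4 y]
    nlinarith [mul_nonneg (sub_nonneg.2 hpy.1) (zero_le_one.trans h3)]

theorem IsWalk.measure_stay_below {P : Measure Ω} [IsFiniteMeasure P] {p : ℕ → ℝ} {X : ℕ → Ω → ℕ}
    (hX : IsWalk P p X) (hp : ∀ n, 1 ≤ n → 1 / 3 ≤ p n ∧ p n < 1) (n : ℕ) :
    P {ω | ∀ s, X s ω < n} = 0 := by
  set g := P {ω | ∀ s, X s ω < n}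
  set v : ℕ → ℝ≥0∞ := fun t => ∫⁻ ω in stay X (Set.Iio n) t, lyapunov n (X t ω) ∂P
  -- Each unit of time spends at least the mass `g` out of the finite budget `v 0`.
  have hstep : ∀ t, v (t + 1) + g ≤ v t := by
    intro t
    have h1 : v (t + 1) ≤ ∫⁻ ω in stay X (Set.Iio n) t, lyapunov n (X (t + 1) ω) ∂P :=
      lintegral_mono_set fun ω hω s hs => hω s (by omega)
    have h2 : g ≤ ∫⁻ ω in stay X (Set.Iio n) t, 1 ∂P := by
      rw [setLIntegral_one]
      exact measure_mono fun ω hω s _ => hω s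
    rw [hX.lintegral_step (past_stay X _ t)] at h1
    refine (add_le_add h1 h2).trans ?_
    rw [← lintegral_add_right _ measurable_const]
    refine setLIntegral_mono' ((past_stay X _ t).measurableSet hX.measurable) fun ω hω => ?_
    exact avg_lyapunov hp (hω t le_rfl)
  have hsum : ∀ t : ℕ, v t + t * g ≤ v 0 := by
    intro t
    induction t with
    | zero => simp
    | succ t ih =>
      refine le_trans ?_ ih
      calc v (t + 1) + ((t + 1 : ℕ) : ℝ≥0∞) * g = (v (t + 1) + g) + t * g := by push_cast; ring
        _ ≤ _ := by gcongr; exact hstep t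
  have hv0 : v 0 ≠ ∞ := by
    refine ne_top_of_le_ne_top ?_ (lintegral_mono
      (g := fun _ => ENNReal.ofReal (4 ^ (n + 2))) fun ω => ?_)
    · rw [lintegral_const]
      exact ENNReal.mul_ne_top ENNReal.ofReal_ne_top (measure_ne_top _ _)
    · exact ENNReal.ofReal_le_ofReal (by have : (0 : ℝ) ≤ 4 ^ X 0 ω := by positivity
                                         linarith)
  by_contra hg
  obtain ⟨N, hN⟩ := ENNReal.exists_nat_mul_gt hg hv0
  exact absurd (le_add_self.trans (hsum N)) (not_le.2 hN)

theorem IsWalk.ae_unbounded {P : Measure Ω} [IsFiniteMeasure P] {p : ℕ → ℝ} {X : ℕ → Ω → ℕ}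
    (hX : IsWalk P p X) (hp : ∀ n, 1 ≤ n → 1 / 3 ≤ p n ∧ p n < 1) :
    ∀ᵐ ω ∂P, ∀ n, ∃ s, n ≤ X s ω := by
  refine ae_all_iff.2 fun n => ?_
  rw [ae_iff]
  convert hX.measure_stay_below hp n using 4
  simp

end Unbounded

section Gambler

variable {P : Measure Ω} {p ξ : ℕ → ℝ} {X : ℕ → Ω → ℕ}

theorem avg_DFin (hξ : IsTailSolution p ξ) (hp : ∀ n, 1 ≤ n → 1 / 3 ≤ p n ∧ p n < 1)
    {m x : ℕ} (hx : m < x) :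
    avg p (fun x => ENNReal.ofReal (DFin ξ m x)) x = ENNReal.ofReal (DFin ξ m x) := by
  obtain ⟨y, rfl⟩ : ∃ y, x = y + 1 := ⟨x - 1, by omega⟩
  have hpy := hp (y + 1) (by omega)
  rw [avg_succ, ← ENNReal.ofReal_mul (by linarith), ← ENNReal.ofReal_mul (by linarith),
    ← ENNReal.ofReal_add (mul_nonneg (by linarith) (hξ.DFin_nonneg _ _))
      (mul_nonneg (by linarith) (hξ.DFin_nonneg _ _)),
    hξ.DFin_harmonic (by linarith) (by omega)]

/-- One step of optional stopping on (m, n): the walk stays inside, or leaves upwards with payoff c.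
Leaving down to m pays nothing, in accordance with the value of `DFin ξ m` there. -/
theorem IsWalk.lintegral_exit (hX : IsWalk P p X) (f : ℕ → ℝ≥0∞) (m n t : ℕ) (c : ℝ≥0∞) :
    ∫⁻ ω in stay X (Set.Ioo m n) t, ({ω | X (t + 1) ω ∈ Set.Ioo m n}.indicator
        (fun ω => f (X (t + 1) ω)) ω + {ω | n ≤ X (t + 1) ω}.indicator (fun _ => c) ω) ∂P =
      ∫⁻ ω in stay X (Set.Ioo m n) (t + 1), f (X (t + 1) ω) ∂P + c * P (reach X m n t) := by
  have m1 : MeasurableSet {ω | X (t + 1) ω ∈ Set.Ioo m n} :=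
    hX.measurable (t + 1) measurableSet_Ioo
  have m2 : MeasurableSet {ω | n ≤ X (t + 1) ω} := hX.measurable (t + 1) measurableSet_Ici
  rw [lintegral_add_right _ (measurable_const.indicator m2), setLIntegral_indicator m1,
    setLIntegral_indicator m2, setLIntegral_const, stay_succ, reach, Set.inter_comm {ω | n ≤ _}]

theorem IsWalk.lintegral_DFin_step (hX : IsWalk P p X) (hξ : IsTailSolution p ξ)
    (hp : ∀ n, 1 ≤ n → 1 / 3 ≤ p n ∧ p n < 1) (m n t : ℕ) :
    ∫⁻ ω in stay X (Set.Ioo m n) t, ENNReal.ofReal (DFin ξ m (X (t + 1) ω)) ∂P =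
    ∫⁻ ω in stay X (Set.Ioo m n) t, ENNReal.ofReal (DFin ξ m (X t ω)) ∂P := by
  rw [hX.lintegral_step (past_stay X _ t) (fun x => ENNReal.ofReal (DFin ξ m x))]
  exact setLIntegral_congr_fun ((past_stay X _ t).measurableSet hX.measurable) fun ω hω =>
    avg_DFin hξ hp (hω t le_rfl).1

theorem lintegral_DFin_zero {m n : ℕ} (ha : ∀ᵐ ω ∂P, X 0 ω = m + 1)
    (hmn : m + 1 < n) :
    ∫⁻ ω in stay X (Set.Ioo m n) 0, ENNReal.ofReal (DFin ξ m (X 0 ω)) ∂P = P Set.univ := by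
  have h1 : stay X (Set.Ioo m n) 0 =ᵐ[P] Set.univ := by
    filter_upwards [ha] with ω hω
    refine propext ⟨fun _ => trivial, fun _ s hs => ?_⟩
    obtain rfl : s = 0 := by omega
    rw [hω]
    exact ⟨by omega, hmn⟩
  rw [setLIntegral_congr h1, Measure.restrict_univ, ← lintegral_one]
  refine lintegral_congr_ae ?_
  filter_upwards [ha] with ω hω
  rw [hω, DFin_self_succ, ENNReal.ofReal_one]

/-- The stopped martingale starts at `DFin ξ m (m + 1)` = 1 and is at least `DFin ξ m n` after an
upward exit. -/
theorem IsWalk.measure_reach_le [IsFiniteMeasure P] (hX : IsWalk P p X) (hξ : IsTailSolution p ξ)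
    (hp : ∀ n, 1 ≤ n → 1 / 3 ≤ p n ∧ p n < 1) {m n : ℕ} (ha : ∀ᵐ ω ∂P, X 0 ω = m + 1)
    (hmn : m + 1 < n) :
    ENNReal.ofReal (DFin ξ m n) * P (⋃ t, reach X m n t) ≤ P Set.univ := by
  set e : ℕ → ℝ≥0∞ := fun t =>
    ∫⁻ ω in stay X (Set.Ioo m n) t, ENNReal.ofReal (DFin ξ m (X t ω)) ∂P with he
  have hstep : ∀ t, e (t + 1) + ENNReal.ofReal (DFin ξ m n) * P (reach X m n t) ≤ e t := by
    intro t
    simp only [he]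
    rw [← hX.lintegral_DFin_step hξ hp m n t,
      ← hX.lintegral_exit (fun x => ENNReal.ofReal (DFin ξ m x))]
    refine lintegral_mono fun ω => ?_
    by_cases h1 : n ≤ X (t + 1) ω
    · rw [Set.indicator_of_notMem, Set.indicator_of_mem (by exact h1), zero_add]
      · exact ENNReal.ofReal_le_ofReal (hξ.DFin_mono m h1)
      · exact fun h => absurd h.2 (not_lt.2 h1)
    · rw [Set.indicator_of_notMem (s := {ω | n ≤ X (t + 1) ω}) (by exact h1), add_zero]
      exact Set.indicator_le_self _ _ _
  have hsum : ∀ T, e T + ∑ t ∈ Finset.range T,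
      ENNReal.ofReal (DFin ξ m n) * P (reach X m n t) ≤ e 0 := by
    intro T
    induction T with
    | zero => simp
    | succ T ih =>
      refine le_trans ?_ ih
      rw [Finset.sum_range_succ, add_comm (Finset.sum _ _), ← add_assoc]
      gcongr
      exact hstep T
  rw [measure_iUnion (reach_disjoint X m n) fun t =>
    (past_reach X m n t).measurableSet hX.measurable, ← ENNReal.tsum_mul_left,
    ← lintegral_DFin_zero (ξ := ξ) ha hmn, ENNReal.tsum_eq_iSup_nat]
  exact iSup_le fun T => le_add_self.trans (hsum T)

/-- Jumps have size at most two, so an upward exit lands at most at n + 1; and the mass still inside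
(m, n) tends to zero, so no part of the martingale is lost in the limit. -/
theorem IsWalk.le_measure_reach [IsFiniteMeasure P] (hX : IsWalk P p X) (hξ : IsTailSolution p ξ)
    (hp : ∀ n, 1 ≤ n → 1 / 3 ≤ p n ∧ p n < 1) {m n : ℕ} (ha : ∀ᵐ ω ∂P, X 0 ω = m + 1)
    (hmn : m + 1 < n) :
    P Set.univ ≤ ENNReal.ofReal (DFin ξ m (n + 1)) * P (⋃ t, reach X m n t) := by
  set c := ENNReal.ofReal (DFin ξ m (n + 1))
  set e : ℕ → ℝ≥0∞ := fun t =>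
    ∫⁻ ω in stay X (Set.Ioo m n) t, ENNReal.ofReal (DFin ξ m (X t ω)) ∂P with he
  have hstep : ∀ t, e t ≤ e (t + 1) + c * P (reach X m n t) := by
    intro t
    simp only [he]
    rw [← hX.lintegral_DFin_step hξ hp m n t,
      ← hX.lintegral_exit (fun x => ENNReal.ofReal (DFin ξ m x))]
    refine setLIntegral_mono_ae' ((past_stay X _ t).measurableSet hX.measurable) ?_
    filter_upwards [hX.ae_legal] with ω hleg hω
    by_cases h1 : n ≤ X (t + 1) ω
    · rw [Set.indicator_of_mem (s := {ω | n ≤ X (t + 1) ω}) (by exact h1)]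
      refine le_trans (ENNReal.ofReal_le_ofReal (hξ.DFin_mono m ?_)) le_add_self
      have h2 := (hω t le_rfl).2
      have h3 : X (t + 1) ω = X t ω + 2 ∨ X (t + 1) ω + 1 = X t ω := hleg t
      omega
    · rcases Nat.lt_or_ge m (X (t + 1) ω) with h2 | h2
      · rw [Set.indicator_of_mem (s := {ω | X (t + 1) ω ∈ Set.Ioo m n})
          (by exact ⟨h2, not_le.1 h1⟩)]
        exact le_self_add
      · rw [DFin_of_le ξ h2, ENNReal.ofReal_zero]
        exact zero_le
  have hsum : ∀ T, e 0 ≤ e T + c * P (⋃ t, reach X m n t) := by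
    have aux : ∀ T, e 0 ≤ e T + ∑ t ∈ Finset.range T, c * P (reach X m n t) := by
      intro T
      induction T with
      | zero => simp
      | succ T ih =>
        refine ih.trans ?_
        rw [Finset.sum_range_succ, add_comm (Finset.sum _ _), ← add_assoc]
        gcongr
        exact hstep T
    intro T
    refine (aux T).trans ?_
    rw [measure_iUnion (reach_disjoint X m n) fun t =>
      (past_reach X m n t).measurableSet hX.measurable, ← ENNReal.tsum_mul_left]
    gcongr
    exact ENNReal.sum_le_tsum _
  have hlim : Tendsto e atTop (𝓝 0) := by
    have hle : ∀ T, e T ≤ ENNReal.ofReal (DFin ξ m n) * P (stay X (Set.Ioo m n) T) := by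
      intro T
      simp only [he]
      rw [← setLIntegral_const]
      refine setLIntegral_mono' ((past_stay X _ T).measurableSet hX.measurable) fun ω hω => ?_
      exact ENNReal.ofReal_le_ofReal (hξ.DFin_mono m (hω T le_rfl).2.le)
    have h0 : P (⋂ T, stay X (Set.Ioo m n) T) = 0 := by
      exact measure_mono_null (t := {ω | ∀ s, X s ω < n})
        (fun ω hω s => (Set.mem_iInter.1 hω s s le_rfl).2) (hX.measure_stay_below hp n)
    have h1 : Tendsto (fun T => P (stay X (Set.Ioo m n) T)) atTop (𝓝 0) := by
      rw [← h0]
      refine tendsto_measure_iInter_atTop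
        (fun T => ((past_stay X _ T).measurableSet hX.measurable).nullMeasurableSet) ?_
        ⟨0, measure_ne_top _ _⟩
      exact fun s t hst ω hω i hi => hω i (hi.trans hst)
    have h2 := ENNReal.Tendsto.const_mul (a := ENNReal.ofReal (DFin ξ m n)) h1
      (Or.inr ENNReal.ofReal_ne_top)
    rw [mul_zero] at h2
    exact tendsto_of_tendsto_of_tendsto_of_le_of_le tendsto_const_nhds h2 (fun _ => zero_le) hle
  rw [← lintegral_DFin_zero (ξ := ξ) ha hmn]
  refine ge_of_tendsto' (x := atTop) (f := fun T => e T + c * P (⋃ t, reach X m n t)) ?_ hsum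
  simpa using hlim.add_const (c * P (⋃ t, reach X m n t))

/-- Started at `m + 1`, the walk never visits `m` with probability `1 / D(m)`. -/
theorem IsWalk.measure_escape [IsFiniteMeasure P] (hX : IsWalk P p X) (hξ : IsTailSolution p ξ)
    (hp : ∀ n, 1 ≤ n → 1 / 3 ≤ p n ∧ p n < 1) {m : ℕ} (ha : ∀ᵐ ω ∂P, X 0 ω = m + 1) :
    P {ω | ∀ s, X s ω ≠ m} = P Set.univ / D ξ m := by
  have hD0 : D ξ m ≠ 0 := (lt_of_lt_of_le zero_lt_one (one_le_D ξ m)).ne'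
  apply le_antisymm
  · rw [ENNReal.le_div_iff_mul_le (Or.inl hD0) (Or.inr (measure_ne_top _ _)), D, ENNReal.mul_iSup]
    refine iSup_le fun n => ?_
    have hn : ENNReal.ofReal (DFin ξ m n) ≤ ENNReal.ofReal (DFin ξ m (n + m + 2)) :=
      ENNReal.ofReal_le_ofReal (hξ.DFin_mono m (by omega))
    refine le_trans ?_ (hX.measure_reach_le hξ hp ha (n := n + m + 2) (by omega))
    rw [mul_comm]
    refine mul_le_mul' hn (measure_mono_ae ?_)
    filter_upwards [hX.ae_legal, hX.ae_unbounded hp, ha] with ω hleg hunb h0 hω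
    have hlt : ∀ t, m < X t ω := fun t =>
      hleg.lt_of_ne (s := 0) (by rw [h0]; omega) (Nat.zero_le t) (fun i _ _ => hω i)
    obtain ⟨s, hs⟩ := hunb (n + m + 2)
    obtain ⟨t, -, h1, h2⟩ := exists_first_passage (x := fun t => X t ω) (by rw [h0]; omega) hs
    exact Set.mem_iUnion.2 ⟨t, fun i hi => ⟨hlt i, h1 i hi⟩, h2⟩
  · by_cases hD : D ξ m = ∞
    · rw [hD, ENNReal.div_top]
      exact zero_le
    rw [ENNReal.div_le_iff hD0 hD, mul_comm]
    -- `R n`: the walk reaches [n, ∞) while still above m. These events decrease, and a path in all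
    -- of them never visits m.
    set R : ℕ → Set Ω := fun n => ⋃ t, {ω | n ≤ X t ω} ∩ stay X (Set.Ioi m) t with hR
    have hmeas : ∀ n, MeasurableSet (R n) := fun n => MeasurableSet.iUnion fun t =>
      (hX.measurable t measurableSet_Ici).inter ((past_stay X _ t).measurableSet hX.measurable)
    have hle : ∀ n, P Set.univ ≤ D ξ m * P (R n) := by
      intro n
      refine (hX.le_measure_reach hξ hp ha (n := n + m + 2) (by omega)).trans
        (mul_le_mul' (DFin_le_D ξ m _) (measure_mono ?_))
      refine Set.iUnion_subset fun t => ?_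
      rintro ω ⟨h1, h2⟩
      refine Set.mem_iUnion.2 ⟨t + 1, le_trans (by omega) (show n + m + 2 ≤ _ from h2), ?_⟩
      intro s hs
      rcases Nat.lt_or_ge t s with h | h
      · obtain rfl : s = t + 1 := by omega
        exact lt_of_lt_of_le (by omega) (show n + m + 2 ≤ _ from h2)
      · exact (h1 s h).1
    have hlim : Tendsto (fun n => D ξ m * P (R n)) atTop (𝓝 (D ξ m * P (⋂ n, R n))) := by
      refine ENNReal.Tendsto.const_mul (tendsto_measure_iInter_atTop
        (fun n => (hmeas n).nullMeasurableSet) ?_ ⟨0, measure_ne_top _ _⟩) (Or.inr hD)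
      intro a b hab
      refine Set.iUnion_mono fun t => Set.inter_subset_inter_left _ fun ω hω => ?_
      exact le_trans hab hω
    refine (ge_of_tendsto' hlim hle).trans (mul_le_mul' le_rfl (measure_mono ?_))
    intro ω hω s hs
    -- A level above all positions up to time s, which forces the passage time t to come after s.
    obtain ⟨t, h1, h2⟩ := Set.mem_iUnion.1
      (Set.mem_iInter.1 hω (∑ i ∈ Finset.range (s + 1), X i ω + 1))
    have hts : s < t := by
      by_contra hcon
      have h3 : X t ω ≤ ∑ i ∈ Finset.range (s + 1), X i ω :=
        Finset.single_le_sum (f := fun i => X i ω) (fun _ _ => Nat.zero_le _)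
          (Finset.mem_range.2 (by omega))
      have h4 : ∑ i ∈ Finset.range (s + 1), X i ω + 1 ≤ X t ω := h1
      omega
    have := h2 s hts.le
    rw [hs] at this
    exact lt_irrefl m this

end Gambler

end SkipWalk

/-! ### Jumping over a point, and probabilities of skipping one or two points. -/

namespace SkipWalk

/-- The walk stays in `B` and below `k` up to time `t`, and jumps over `k` at time `t + 1`. -/
def pass {Ω : Type*} (X : ℕ → Ω → ℕ) (B : Set ℕ) (k t : ℕ) : Set Ω :=
  stay X (B ∩ Set.Iio k) t ∩ {ω | X (t + 1) ω = k + 1}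

theorem past_pass {Ω : Type*} (X : ℕ → Ω → ℕ) (B : Set ℕ) (k t : ℕ) :
    Past X (t + 1) (pass X B k t) :=
  ((past_stay X _ t).mono t.le_succ).inter (past_preimage X le_rfl {k + 1})

theorem pass_disjoint {Ω : Type*} (X : ℕ → Ω → ℕ) (B : Set ℕ) (k : ℕ) :
    Pairwise (Function.onFun Disjoint (pass X B k)) := by
  have key : ∀ s t, s < t → Disjoint (pass X B k s) (pass X B k t) := by
    intro s t hst
    rw [Set.disjoint_left]
    rintro ω ⟨_, h1⟩ ⟨h2, _⟩
    have h3 : X (s + 1) ω < k := (h2 (s + 1) (by omega)).2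
    have h4 : X (s + 1) ω = k + 1 := h1
    omega
  intro s t hst
  rcases lt_or_gt_of_ne hst with h | h
  · exact key s t h
  · exact (key t s h).symm

/-- The walk jumps over `k` from inside `B`, and its trajectory from then on is in `S`. -/
def passThen {Ω : Type*} (X : ℕ → Ω → ℕ) (B : Set ℕ) (k : ℕ) (S : Set (ℕ → ℕ)) : Set Ω :=
  ⋃ t, pass X B k t ∩ {ω | (fun i => X (t + 1 + i) ω) ∈ S}

theorem passThen_univ {Ω : Type*} (X : ℕ → Ω → ℕ) (B : Set ℕ) (k : ℕ) :
    passThen X B k Set.univ = ⋃ t, pass X B k t := by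
  simp [passThen]

/-- The first passage from below k lands on k or on k + 1, and for a skipped point only the latter
is possible. -/
theorem skipped_iff_passThen {Ω : Type*} {X : ℕ → Ω → ℕ} {ω : Ω} (hleg : Legal fun t => X t ω)
    (hunb : ∀ n, ∃ s, n ≤ X s ω) {k : ℕ} (h0 : X 0 ω < k) :
    k ∈ skipped X ω ↔ ω ∈ passThen X Set.univ k {y | ∀ i, y i ≠ k} := by
  constructor
  · intro hk
    obtain ⟨s, hs⟩ := hunb k
    obtain ⟨t, -, h1, h2⟩ := exists_first_passage (x := fun t => X t ω) h0 hs
    have h3 := hk (t + 1)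
    have h4 := h1 t le_rfl
    have h5 : X (t + 1) ω = X t ω + 2 ∨ X (t + 1) ω + 1 = X t ω := hleg t
    refine Set.mem_iUnion.2 ⟨t, ⟨fun i hi => ⟨trivial, h1 i hi⟩, ?_⟩, fun i => hk _⟩
    change X (t + 1) ω = k + 1
    omega
  · intro h
    obtain ⟨t, ⟨h1, -⟩, h2⟩ := Set.mem_iUnion.1 h
    intro n
    rcases Nat.lt_or_ge t n with hn | hn
    · have := h2 (n - (t + 1))
      simpa [show t + 1 + (n - (t + 1)) = n by omega] using this
    · exact (show X n ω < k from (h1 n hn).2).ne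

variable {Ω : Type*} [MeasurableSpace Ω] {P : Measure Ω} {p ξ : ℕ → ℝ} {X : ℕ → Ω → ℕ}

theorem measurableSet_passThen (hX : IsWalk P p X) (B : Set ℕ) (k : ℕ) {S : Set (ℕ → ℕ)}
    (hS : MeasurableSet S) (t : ℕ) :
    MeasurableSet (pass X B k t ∩ {ω | (fun i => X (t + 1 + i) ω) ∈ S}) :=
  ((past_pass X B k t).measurableSet hX.measurable).inter
    ((measurable_pi_lambda _ fun i => hX.measurable (t + 1 + i)) hS)

theorem measure_passThen (hX : IsWalk P p X) (B : Set ℕ) (k : ℕ) {S : Set (ℕ → ℕ)}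
    (hS : MeasurableSet S) :
    P (passThen X B k S) =
      ∑' t, P.restrict (pass X B k t) {ω | (fun i => X (t + 1 + i) ω) ∈ S} := by
  rw [passThen, measure_iUnion]
  · refine tsum_congr fun t => ?_
    rw [Set.inter_comm]
    exact (Measure.restrict_apply
      ((measurable_pi_lambda _ fun i => hX.measurable (t + 1 + i)) hS)).symm
  · exact fun s t hst => (pass_disjoint X B k hst).mono Set.inter_subset_left Set.inter_subset_left
  · exact measurableSet_passThen hX B k hS

theorem IsWalk.shift_pass (hX : IsWalk P p X) (B : Set ℕ) (k t : ℕ) :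
    IsWalk (P.restrict (pass X B k t)) p (fun i => X (t + 1 + i)) ∧
      ∀ᵐ ω ∂(P.restrict (pass X B k t)), X (t + 1 + 0) ω = k + 1 :=
  ⟨hX.shift (past_pass X B k t), (ae_restrict_iff' ((past_pass X B k t).measurableSet
    hX.measurable)).2 (Eventually.of_forall fun _ hω => hω.2)⟩

theorem measurableSet_forall_ne (k : ℕ) : MeasurableSet {y : ℕ → ℕ | ∀ i, y i ≠ k} := by
  have : {y : ℕ → ℕ | ∀ i, y i ≠ k} = ⋂ i, {y | y i ≠ k} := by ext; simp
  rw [this]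
  refine MeasurableSet.iInter fun i => ?_
  have h : Measurable fun y : ℕ → ℕ => y i := measurable_pi_apply i
  exact (h (measurableSet_singleton k)).compl

theorem IsWalk.measure_passThen_ne [IsFiniteMeasure P] (hX : IsWalk P p X)
    (hξ : IsTailSolution p ξ) (hp : ∀ n, 1 ≤ n → 1 / 3 ≤ p n ∧ p n < 1) (B : Set ℕ) (k : ℕ) :
    P (passThen X B k {y | ∀ i, y i ≠ k}) = P (passThen X B k Set.univ) / D ξ k := by
  rw [measure_passThen hX B k (measurableSet_forall_ne k), measure_passThen hX B k .univ,
    div_eq_mul_inv, ← ENNReal.tsum_mul_right]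
  refine tsum_congr fun t => ?_
  obtain ⟨h1, h2⟩ := hX.shift_pass B k t
  have := h1.measure_escape hξ hp h2
  rw [← div_eq_mul_inv]
  exact this

/-- The trajectory after the jump over `k` does not depend on the trajectory before it. -/
theorem IsWalk.measure_passThen_mul [IsFiniteMeasure P] (hX : IsWalk P p X) (B B' : Set ℕ) (k : ℕ)
    {S : Set (ℕ → ℕ)} (hS : MeasurableSet S) :
    P (passThen X B' k Set.univ) * P (passThen X B k S) =
      P (passThen X B k Set.univ) * P (passThen X B' k S) := by
  simp only [measure_passThen hX _ k hS, measure_passThen hX _ k .univ, ← ENNReal.tsum_mul_left,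
    ← ENNReal.tsum_mul_right]
  rw [ENNReal.tsum_comm]
  refine tsum_congr fun s => tsum_congr fun t => ?_
  exact (hX.shift_pass B k t).1.law_unique (hX.shift_pass B' k s).1 (hX.shift_pass B k t).2
    (hX.shift_pass B' k s).2 hS

/-- When the walk leaves `[0, k)` upwards, it jumps over `k` with probability at least `1 / 28`. -/
theorem IsWalk.measure_cross_le (hX : IsWalk P p X) (hp : ∀ n, 1 ≤ n → 1 / 3 ≤ p n ∧ p n < 1)
    {B : Set ℕ} {j : ℕ} (hj : 1 ≤ j) (h1 : j ∈ B) (h2 : j + 2 ∈ B) (hq : p (j + 1) ≤ 2 / 3) :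
    P (⋃ t, stay X (B ∩ Set.Iio (j + 3)) t ∩ {ω | j + 3 ≤ X (t + 1) ω}) ≤
      28 * P (passThen X B (j + 3) Set.univ) := by
  have hC : ∀ t, Past X t (stay X (B ∩ Set.Iio (j + 3)) t ∩ {ω | X t ω ∈ ({j + 1} : Set ℕ)}) :=
    fun t => (past_stay X _ t).inter (past_preimage X le_rfl {j + 1})
  set c : ℕ → ℝ≥0∞ := fun t =>
    P (stay X (B ∩ Set.Iio (j + 3)) t ∩ {ω | X t ω ∈ ({j + 1} : Set ℕ)}) with hc
  -- Landing on j + 3 requires a jump from j + 1. From there the detour j + 1 → j → j + 2 → j + 4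
  -- passes over j + 3 instead, and each of its three steps has probability at least 1/3. Hence 27
  -- here, and 28 = 1 + 27 in the conclusion.
  have hpass : ∀ t, c t ≤ 27 * P (pass X B (j + 3) (t + 2)) := by
    intro t
    set C₀ := stay X (B ∩ Set.Iio (j + 3)) t ∩ {ω | X t ω ∈ ({j + 1} : Set ℕ)} with hC0
    have p1 : Past X (t + 1) (C₀ ∩ {ω | X (t + 1) ω = j}) :=
      ((hC t).mono t.le_succ).inter (past_preimage X le_rfl {j})
    have p2 : Past X (t + 2) (C₀ ∩ {ω | X (t + 1) ω = j} ∩ {ω | X (t + 2) ω = j + 2}) :=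
      (p1.mono (Nat.le_succ _)).inter (past_preimage X le_rfl {j + 2})
    have e1 := hX.measure_step (hC t) (a := j + 1) (fun ω h => h.2) j
    have e2 := hX.measure_step p1 (fun ω h => h.2) (j + 2)
    have e3 := hX.measure_step p2 (fun ω h => h.2) (j + 4)
    rw [e2, e1] at e3
    have t1 : trans p (j + 1) j = 1 - p (j + 1) := by
      simp [trans, show j ≠ j + 1 + 2 by omega]
    have t2 : trans p j (j + 2) = p j := by simp [trans, show j ≠ 0 by omega]
    have t3 : trans p (j + 2) (j + 4) = p (j + 2) := by simp [trans]
    rw [t1, t2, t3] at e3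
    have hsub : C₀ ∩ {ω | X (t + 1) ω = j} ∩ {ω | X (t + 2) ω = j + 2} ∩
        {ω | X (t + 2 + 1) ω = j + 4} ⊆ pass X B (j + 3) (t + 2) := by
      rintro ω ⟨⟨⟨⟨g1, -⟩, g2⟩, g3⟩, g4⟩
      refine ⟨fun s hs => ?_, g4⟩
      rcases Nat.lt_or_ge t s with h | h
      · rcases Nat.lt_or_ge (t + 1) s with h' | h'
        · obtain rfl : s = t + 2 := by omega
          rw [show X (t + 2) ω = j + 2 from g3]
          exact ⟨h2, show j + 2 < j + 3 by omega⟩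
        · obtain rfl : s = t + 1 := by omega
          rw [show X (t + 1) ω = j from g2]
          exact ⟨h1, show j < j + 3 by omega⟩
      · exact g1 s h
    have hle := measure_mono (μ := P) hsub
    rw [e3] at hle
    have third : ∀ x : ℝ, 1 / 3 ≤ x → (1 : ℝ≥0∞) ≤ 3 * ENNReal.ofReal x := by
      intro x hx
      have : ENNReal.ofReal 3 * ENNReal.ofReal x = 3 * ENNReal.ofReal x := by norm_num
      rw [← this, ← ENNReal.ofReal_mul (by norm_num), ← ENNReal.ofReal_one]
      exact ENNReal.ofReal_le_ofReal (by linarith)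
    calc c t = P C₀ * 1 * 1 * 1 := by simp [hc, hC0]
      _ ≤ P C₀ * (3 * ENNReal.ofReal (1 - p (j + 1))) * (3 * ENNReal.ofReal (p j)) *
          (3 * ENNReal.ofReal (p (j + 2))) := by
        gcongr
        · exact third _ (by linarith)
        · exact third _ (hp _ hj).1
        · exact third _ (hp _ (by omega)).1
      _ = 27 * (P C₀ * ENNReal.ofReal (1 - p (j + 1)) * ENNReal.ofReal (p j) *
          ENNReal.ofReal (p (j + 2))) := by ring
      _ ≤ _ := by gcongr
  have hle : ∀ t, P (stay X (B ∩ Set.Iio (j + 3)) t ∩ {ω | j + 3 ≤ X (t + 1) ω}) ≤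
      P (pass X B (j + 3) t) + c t := by
    intro t
    refine le_trans (measure_mono_ae ?_) (measure_union_le _ _)
    filter_upwards [hX.ae_legal] with ω hleg
    rintro ⟨g1, g2⟩
    have g3 : X t ω < j + 3 := (g1 t le_rfl).2
    have g4 : X (t + 1) ω = X t ω + 2 ∨ X (t + 1) ω + 1 = X t ω := hleg t
    have g5 : j + 3 ≤ X (t + 1) ω := g2
    rcases Nat.lt_or_ge (X t ω) (j + 2) with h | h
    · exact Or.inr ⟨g1, show X t ω = j + 1 by omega⟩
    · exact Or.inl ⟨g1, show X (t + 1) ω = j + 3 + 1 by omega⟩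
  rw [passThen_univ, measure_iUnion (pass_disjoint X B _) fun t =>
    (past_pass X B _ t).measurableSet hX.measurable]
  calc _ ≤ ∑' t, P (stay X (B ∩ Set.Iio (j + 3)) t ∩ {ω | j + 3 ≤ X (t + 1) ω}) :=
        measure_iUnion_le _
    _ ≤ ∑' t, (P (pass X B (j + 3) t) + 27 * P (pass X B (j + 3) (t + 2))) :=
        ENNReal.tsum_le_tsum fun t => (hle t).trans (by gcongr; exact hpass t)
    _ = ∑' t, P (pass X B (j + 3) t) + 27 * ∑' t, P (pass X B (j + 3) (t + 2)) := by
        rw [ENNReal.tsum_add, ENNReal.tsum_mul_left]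
    _ ≤ ∑' t, P (pass X B (j + 3) t) + 27 * ∑' t, P (pass X B (j + 3) t) := by
        gcongr 2
        exact ENNReal.tsum_comp_le_tsum_of_injective (f := fun t : ℕ => t + 2)
          (fun a b h => by simpa using h) (fun t => P (pass X B (j + 3) t))
    _ = 28 * ∑' t, P (pass X B (j + 3) t) := by ring

theorem IsWalk.le_measure_pass [IsFiniteMeasure P] (hX : IsWalk P p X)
    (hp : ∀ n, 1 ≤ n → 1 / 3 ≤ p n ∧ p n < 1) {k : ℕ} (hk : 4 ≤ k) (hq : p (k - 2) ≤ 2 / 3)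
    (h0 : ∀ᵐ ω ∂P, X 0 ω < k) :
    P Set.univ ≤ 28 * P (passThen X Set.univ k Set.univ) := by
  obtain ⟨j, rfl⟩ : ∃ j, k = j + 3 := ⟨k - 3, by omega⟩
  refine le_trans ?_ (hX.measure_cross_le hp (j := j) (by omega) trivial trivial hq)
  refine measure_mono_ae ?_
  filter_upwards [hX.ae_unbounded hp, h0] with ω hunb hω _
  obtain ⟨s, hs⟩ := hunb (j + 3)
  obtain ⟨t, -, h1, h2⟩ := exists_first_passage (x := fun t => X t ω) hω hs
  exact Set.mem_iUnion.2 ⟨t, fun i hi => ⟨trivial, h1 i hi⟩, h2⟩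

/-- To get over l while avoiding k, the walk must jump to k + 1 at its first passage over k and then
reach l before k. -/
theorem IsWalk.measure_pass_ne_le [IsFiniteMeasure P] (hX : IsWalk P p X)
    (hξ : IsTailSolution p ξ) (hp : ∀ n, 1 ≤ n → 1 / 3 ≤ p n ∧ p n < 1) {k l : ℕ}
    (hkl : k + 1 < l) (h0 : ∀ᵐ ω ∂P, X 0 ω < k) :
    ENNReal.ofReal (DFin ξ k l) * P (passThen X {k}ᶜ l Set.univ) ≤ P Set.univ := by
  have hsub : P (passThen X {k}ᶜ l Set.univ) ≤ P (⋃ t', pass X Set.univ k t' ∩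
      ⋃ s, reach (fun i => X (t' + 1 + i)) k l s) := by
    refine measure_mono_ae ?_
    filter_upwards [hX.ae_legal, h0] with ω hleg hω hmem
    rw [passThen_univ] at hmem
    obtain ⟨t, g1, g2⟩ := Set.mem_iUnion.1 hmem
    have g2' : X (t + 1) ω = l + 1 := g2
    obtain ⟨t', g3, g4, g5⟩ := exists_first_passage (x := fun t => X t ω) (s := t + 1) hω
      (by rw [g2']; omega)
    have g6 : X (t' + 1) ω = X t' ω + 2 ∨ X (t' + 1) ω + 1 = X t' ω := hleg t'
    have g7 := g4 t' le_rfl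
    have g8 : t' ≠ t := by
      rintro rfl
      omega
    have g9 : X (t' + 1) ω ≠ k := (g1 (t' + 1) (by omega)).1
    have g10 : X (t' + 1) ω = k + 1 := by
      have g5' : k ≤ X (t' + 1) ω := g5
      have g7' : X t' ω < k := g7
      omega
    refine Set.mem_iUnion.2 ⟨t', ⟨fun i hi => ⟨trivial, g4 i hi⟩, g10⟩, ?_⟩
    refine Set.mem_iUnion.2 ⟨t - t' - 1, fun s hs => ⟨?_, ?_⟩, ?_⟩
    · exact hleg.lt_of_ne (s := t' + 1) (by simp only [g10]; omega) (by omega)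
        fun i _ hi => (g1 i (by omega)).1
    · exact (g1 (t' + 1 + s) (by omega)).2
    · change l ≤ X (t' + 1 + (t - t' - 1 + 1)) ω
      rw [show t' + 1 + (t - t' - 1 + 1) = t + 1 by omega, g2']
      omega
  refine (mul_le_mul' le_rfl (hsub.trans (measure_iUnion_le _))).trans ?_
  rw [← ENNReal.tsum_mul_left]
  calc _ ≤ ∑' t', P (pass X Set.univ k t') := by
        refine ENNReal.tsum_le_tsum fun t' => ?_
        obtain ⟨w1, w2⟩ := hX.shift_pass Set.univ k t'
        have := w1.measure_reach_le hξ hp w2 hkl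
        rwa [Measure.restrict_apply_univ, Measure.restrict_apply (MeasurableSet.iUnion fun s =>
          (past_reach _ k l s).measurableSet w1.measurable), Set.inter_comm] at this
    _ = P (⋃ t', pass X Set.univ k t') := (measure_iUnion (pass_disjoint X _ k) fun t =>
        (past_pass X _ k t).measurableSet hX.measurable).symm
    _ ≤ _ := measure_mono (Set.subset_univ _)

/-- Here 784 = 28 · 28: one factor for jumping over k, one for leaving [0, l) by a jump over l. The
gap of 4 keeps the detour of `measure_cross_le` below l strictly above k. -/
theorem IsWalk.le_measure_pass_ne [IsFiniteMeasure P] (hX : IsWalk P p X)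
    (hξ : IsTailSolution p ξ) (hp : ∀ n, 1 ≤ n → 1 / 3 ≤ p n ∧ p n < 1) {k l : ℕ}
    (hkl : k + 4 ≤ l) (hk : 4 ≤ k) (hqk : p (k - 2) ≤ 2 / 3) (hql : p (l - 2) ≤ 2 / 3)
    (h0 : ∀ᵐ ω ∂P, X 0 ω < k) :
    P Set.univ ≤ 784 * (ENNReal.ofReal (DFin ξ k (l + 1)) * P (passThen X {k}ᶜ l Set.univ)) := by
  have hsub : ⋃ t', pass X Set.univ k t' ∩
      passThen (fun i => X (t' + 1 + i)) (Set.Ioi k) l Set.univ ⊆ passThen X {k}ᶜ l Set.univ := by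
    refine Set.iUnion_subset fun t' => ?_
    rintro ω ⟨⟨g1, g2⟩, g3⟩
    rw [passThen_univ] at g3 ⊢
    obtain ⟨s, g4, g5⟩ := Set.mem_iUnion.1 g3
    refine Set.mem_iUnion.2 ⟨t' + 1 + s, fun i hi => ?_, g5⟩
    rcases Nat.lt_or_ge t' i with h | h
    · have := g4 (i - (t' + 1)) (by omega)
      simp only [show t' + 1 + (i - (t' + 1)) = i by omega] at this
      exact ⟨(show k < X i ω from this.1).ne', this.2⟩
    · have : X i ω < k := (g1 i h).2
      exact ⟨this.ne, show X i ω < l by omega⟩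
  refine (hX.le_measure_pass hp hk hqk h0).trans ?_
  have hterm : ∀ t', P (pass X Set.univ k t') ≤ 28 * ENNReal.ofReal (DFin ξ k (l + 1)) *
      P (pass X Set.univ k t' ∩ passThen (fun i => X (t' + 1 + i)) (Set.Ioi k) l Set.univ) := by
    intro t'
    obtain ⟨w1, w2⟩ := hX.shift_pass Set.univ k t'
    have e1 := w1.le_measure_reach hξ hp w2 (n := l) (by omega)
    obtain ⟨j, rfl⟩ : ∃ j, l = j + 3 := ⟨l - 3, by omega⟩
    have e2 := w1.measure_cross_le hp (B := Set.Ioi k) (j := j) (by omega)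
      (show k < j by omega) (show k < j + 2 by omega) hql
    rw [Measure.restrict_apply_univ] at e1
    have hm : MeasurableSet (passThen (fun i => X (t' + 1 + i)) (Set.Ioi k) (j + 3) Set.univ) :=
      MeasurableSet.iUnion (measurableSet_passThen w1 _ _ .univ)
    rw [Measure.restrict_apply hm, Set.inter_comm (passThen _ _ _ _)] at e2
    calc _ ≤ _ := e1
      _ ≤ ENNReal.ofReal (DFin ξ k (j + 3 + 1)) * (28 * P (pass X Set.univ k t' ∩
          passThen (fun i => X (t' + 1 + i)) (Set.Ioi k) (j + 3) Set.univ)) :=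
        mul_le_mul' le_rfl e2
      _ = _ := by ring
  rw [passThen_univ, measure_iUnion (pass_disjoint X _ k) fun t =>
    (past_pass X _ k t).measurableSet hX.measurable]
  calc _ ≤ 28 * ∑' t', 28 * ENNReal.ofReal (DFin ξ k (l + 1)) * P (pass X Set.univ k t' ∩
          passThen (fun i => X (t' + 1 + i)) (Set.Ioi k) l Set.univ) := by
        gcongr with t'
        exact hterm t'
    _ = 784 * (ENNReal.ofReal (DFin ξ k (l + 1)) * P (⋃ t', pass X Set.univ k t' ∩
          passThen (fun i => X (t' + 1 + i)) (Set.Ioi k) l Set.univ)) := by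
        rw [ENNReal.tsum_mul_left, measure_iUnion]
        · ring
        · exact fun s t hst => (pass_disjoint X _ k hst).mono Set.inter_subset_left
            Set.inter_subset_left
        · exact fun t' => ((past_pass X _ k t').measurableSet hX.measurable).inter
            (MeasurableSet.iUnion (measurableSet_passThen (hX.shift_pass Set.univ k t').1 _ _ .univ))
    _ ≤ _ := by gcongr

theorem IsWalk.measurableSet_skipped (hX : IsWalk P p X) (k : ℕ) :
    MeasurableSet {ω | k ∈ skipped X ω} :=
  (measurable_pi_lambda _ hX.measurable) (measurableSet_forall_ne k)

theorem IsWalk.measure_skipped [IsFiniteMeasure P] (hX : IsWalk P p X)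
    (hξ : IsTailSolution p ξ) (hp : ∀ n, 1 ≤ n → 1 / 3 ≤ p n ∧ p n < 1) {k : ℕ}
    (h0 : ∀ᵐ ω ∂P, X 0 ω < k) :
    P {ω | k ∈ skipped X ω} = P (passThen X Set.univ k Set.univ) / D ξ k := by
  rw [← hX.measure_passThen_ne hξ hp]
  refine measure_congr ?_
  filter_upwards [hX.ae_legal, hX.ae_unbounded hp, h0] with ω h1 h2 h3
  exact propext (skipped_iff_passThen h1 h2 h3)

theorem IsWalk.measure_skipped_le [IsFiniteMeasure P] (hX : IsWalk P p X)
    (hξ : IsTailSolution p ξ) (hp : ∀ n, 1 ≤ n → 1 / 3 ≤ p n ∧ p n < 1) {k : ℕ}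
    (h0 : ∀ᵐ ω ∂P, X 0 ω < k) : P {ω | k ∈ skipped X ω} ≤ P Set.univ / D ξ k := by
  rw [hX.measure_skipped hξ hp h0]
  gcongr
  exact Set.subset_univ _

theorem IsWalk.le_measure_skipped [IsFiniteMeasure P] (hX : IsWalk P p X)
    (hξ : IsTailSolution p ξ) (hp : ∀ n, 1 ≤ n → 1 / 3 ≤ p n ∧ p n < 1) {k : ℕ} (hk : 4 ≤ k)
    (hq : p (k - 2) ≤ 2 / 3) (h0 : ∀ᵐ ω ∂P, X 0 ω < k) :
    P Set.univ / D ξ k ≤ 28 * P {ω | k ∈ skipped X ω} := by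
  rw [hX.measure_skipped hξ hp h0, div_eq_mul_inv, div_eq_mul_inv, ← mul_assoc]
  gcongr
  exact hX.le_measure_pass hp hk hq h0

/-- The walk avoids k until it jumps over l, which costs D(k, l), and afterwards avoids l, which
costs D(l). -/
theorem IsWalk.measure_skipped_inter_le [IsFiniteMeasure P] (hX : IsWalk P p X)
    (hξ : IsTailSolution p ξ) (hp : ∀ n, 1 ≤ n → 1 / 3 ≤ p n ∧ p n < 1) {k l : ℕ} (hkl : k < l)
    (h0 : ∀ᵐ ω ∂P, X 0 ω < k) :
    ENNReal.ofReal (DFin ξ k l) * P ({ω | k ∈ skipped X ω} ∩ {ω | l ∈ skipped X ω}) ≤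
      P Set.univ / D ξ l := by
  rcases Nat.lt_or_ge (k + 1) l with h | h
  · refine le_trans (b := ENNReal.ofReal (DFin ξ k l) *
      P (passThen X {k}ᶜ l {y | ∀ i, y i ≠ l})) ?_ ?_
    · refine mul_le_mul' le_rfl (measure_mono_ae ?_)
      filter_upwards [hX.ae_legal, hX.ae_unbounded hp, h0] with ω h1 h2 h3
      rintro ⟨h4, h5⟩
      obtain ⟨t, ⟨g1, g2⟩, g3⟩ := Set.mem_iUnion.1
        ((skipped_iff_passThen h1 h2 (k := l) (by omega)).1 h5)
      exact Set.mem_iUnion.2 ⟨t, ⟨fun i hi => ⟨h4 i, (g1 i hi).2⟩, g2⟩, g3⟩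
    · rw [hX.measure_passThen_ne hξ hp, div_eq_mul_inv, div_eq_mul_inv, ← mul_assoc]
      gcongr
      exact hX.measure_pass_ne_le hξ hp h h0
  -- Adjacent points are never both skipped: the jump over k lands on k + 1.
  · obtain rfl : l = k + 1 := by omega
    have : P ({ω | k ∈ skipped X ω} ∩ {ω | k + 1 ∈ skipped X ω}) = 0 := by
      refine measure_eq_zero_iff_ae_notMem.2 ?_
      filter_upwards [hX.ae_legal, hX.ae_unbounded hp, h0] with ω h1 h2 h3
      rintro ⟨h4, h5⟩
      obtain ⟨t, ⟨g1, g2⟩, g3⟩ := Set.mem_iUnion.1 ((skipped_iff_passThen h1 h2 h3).1 h4)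
      exact h5 (t + 1) g2
    rw [this, mul_zero]
    exact zero_le

/-- Conditionally on a jump over `k` and on the trajectory after it, the point `l < k` is not
visited before that jump with probability at least `1 / (784 D(l, k + 1))`. -/
theorem IsWalk.measure_passThen_le [IsFiniteMeasure P] (hX : IsWalk P p X)
    (hξ : IsTailSolution p ξ) (hp : ∀ n, 1 ≤ n → 1 / 3 ≤ p n ∧ p n < 1) {k l : ℕ}
    (hlk : l + 4 ≤ k) (hl : 4 ≤ l) (hql : p (l - 2) ≤ 2 / 3) (hqk : p (k - 2) ≤ 2 / 3)
    (h0 : ∀ᵐ ω ∂P, X 0 ω < l) {S : Set (ℕ → ℕ)} (hS : MeasurableSet S) :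
    P (passThen X Set.univ k S) ≤
      784 * (ENNReal.ofReal (DFin ξ l (k + 1)) * P (passThen X {l}ᶜ k S)) := by
  by_cases hP : P Set.univ = 0
  · rw [measure_mono_null (Set.subset_univ _) hP]
    exact zero_le
  have e1 := hX.le_measure_pass_ne hξ hp hlk hl hql hqk h0
  have e2 := hX.measure_passThen_mul Set.univ {l}ᶜ k hS
  have e3 : P (passThen X Set.univ k Set.univ) ≤ P Set.univ := measure_mono (Set.subset_univ _)
  rw [← ENNReal.mul_le_mul_iff_right hP (measure_ne_top _ _)]
  calc P Set.univ * P (passThen X Set.univ k S)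
      ≤ 784 * (ENNReal.ofReal (DFin ξ l (k + 1)) * P (passThen X {l}ᶜ k Set.univ)) *
        P (passThen X Set.univ k S) := by gcongr
    _ = 784 * (ENNReal.ofReal (DFin ξ l (k + 1)) * (P (passThen X {l}ᶜ k Set.univ) *
        P (passThen X Set.univ k S))) := by ring
    _ ≤ 784 * (ENNReal.ofReal (DFin ξ l (k + 1)) * (P Set.univ * P (passThen X {l}ᶜ k S))) := by
        rw [e2]
        gcongr
    _ = _ := by ring

end SkipWalk

/-! ### Part (i): clustering of skipped points and Borel–Cantelli. -/

namespace SkipWalk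

theorem log_sub_log_le_sum (N : ℕ) (hN : 5 ≤ N) :
    Real.log N - Real.log 5 ≤ ∑ i ∈ Finset.Ico 5 N, 1 / (i : ℝ) := by
  induction N, hN using Nat.le_induction with
  | base => simp
  | succ N hN ih =>
    rw [Finset.sum_Ico_succ_top hN]
    have hpos : (0 : ℝ) < N := by exact_mod_cast (by omega : 0 < N)
    have h1 : Real.log ((N + 1 : ℕ) : ℝ) - Real.log N ≤ 1 / N := by
      rw [← Real.log_div (by positivity) hpos.ne']
      refine (Real.log_le_sub_one_of_pos (by positivity)).trans (le_of_eq ?_)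
      push_cast
      field_simp
      ring
    linarith

/-- With i = k + 1 - l this is a harmonic sum; the gap l ≤ k - 4 of `measure_passThen_le` makes it
start at 5. Since k > 2a it is at least log a - log 5, and 25 = 5 ^ 2 makes this at least half of
log a. -/
theorem half_log_le_sum {a k : ℕ} (ha : 25 ≤ a) (hk : 2 * a < k) :
    Real.log a / 2 ≤ ∑ l ∈ Finset.Ioc a (k - 4), 1 / ((k : ℝ) + 1 - l) := by
  have h1 : ∑ l ∈ Finset.Ioc a (k - 4), 1 / ((k : ℝ) + 1 - l) =
      ∑ i ∈ Finset.Ico 5 (k + 1 - a), 1 / (i : ℝ) := by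
    refine Finset.sum_nbij' (fun l => k + 1 - l) (fun i => k + 1 - i) ?_ ?_ ?_ ?_ ?_
    · intro l hl
      simp only [Finset.mem_Ioc, Finset.mem_Ico] at *
      omega
    · intro l hl
      simp only [Finset.mem_Ioc, Finset.mem_Ico] at *
      omega
    · intro l hl
      simp only [Finset.mem_Ioc] at hl
      omega
    · intro l hl
      simp only [Finset.mem_Ico] at hl
      omega
    · intro l hl
      simp only [Finset.mem_Ioc] at hl
      rw [Nat.cast_sub (by omega)]
      push_cast
      rfl
  rw [h1]
  refine le_trans ?_ (log_sub_log_le_sum _ (by omega))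
  have h2 : Real.log a ≤ Real.log ((k + 1 - a : ℕ) : ℝ) := by
    refine Real.log_le_log (by exact_mod_cast (by omega : 0 < a)) ?_
    exact_mod_cast (by omega : a ≤ k + 1 - a)
  have h3 : Real.log 5 ≤ Real.log a / 2 := by
    have : Real.log ((5 : ℝ) ^ 2) ≤ Real.log a :=
      Real.log_le_log (by norm_num) (by norm_num; exact_mod_cast ha)
    rw [Real.log_pow] at this
    push_cast at this
    linarith
  linarith

/-- `k` is the last skipped point in `[0, b]`. -/
def lastSkipped {Ω : Type*} (X : ℕ → Ω → ℕ) (b k : ℕ) : Set Ω :=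
  {ω | k ∈ skipped X ω ∧ ∀ j, k < j → j ≤ b → j ∉ skipped X ω}

theorem lastSkipped_disjoint {Ω : Type*} (X : ℕ → Ω → ℕ) {b k k' : ℕ} (hk : k ≤ b) (hk' : k' ≤ b)
    (hne : k ≠ k') : Disjoint (lastSkipped X b k) (lastSkipped X b k') := by
  rw [Set.disjoint_left]
  rintro ω ⟨h1, h2⟩ ⟨h3, h4⟩
  rcases lt_or_gt_of_ne hne with h | h
  · exact h2 k' h hk' h3
  · exact h4 k h hk h1

variable {Ω : Type*} [MeasurableSpace Ω] {P : Measure Ω} {p ξ : ℕ → ℝ} {X : ℕ → Ω → ℕ}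

theorem measurableSet_lastSkipped (hX : IsWalk P p X) (b k : ℕ) :
    MeasurableSet (lastSkipped X b k) := by
  have : lastSkipped X b k = {ω | k ∈ skipped X ω} ∩
      ⋂ j ∈ {j | k < j ∧ j ≤ b}, {ω | j ∈ skipped X ω}ᶜ := by
    ext ω
    simp [lastSkipped]
  rw [this]
  exact (hX.measurableSet_skipped k).inter (MeasurableSet.biInter (Set.to_countable _)
    fun j _ => (hX.measurableSet_skipped j).compl)

/-- No point beyond k is visited before the jump over k, so being the last skipped point is a
property of the path after that jump. Whether l < k is skipped depends only on the path before it,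
since afterwards the path stays above k. -/
theorem IsWalk.measure_lastSkipped_le [IsFiniteMeasure P] (hX : IsWalk P p X)
    (hξ : IsTailSolution p ξ) (hp : ∀ n, 1 ≤ n → 1 / 3 ≤ p n ∧ p n < 1) {b k l : ℕ}
    (hlk : l + 4 ≤ k) (hl : 4 ≤ l) (hql : p (l - 2) ≤ 2 / 3) (hqk : p (k - 2) ≤ 2 / 3)
    (h0 : ∀ᵐ ω ∂P, X 0 ω < l) :
    P (lastSkipped X b k) ≤ 784 * (ENNReal.ofReal (DFin ξ l (k + 1)) *
      P ({ω | l ∈ skipped X ω} ∩ lastSkipped X b k)) := by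
  set S : Set (ℕ → ℕ) := {y | ∀ i, y i ≠ k} ∩ ⋂ j ∈ {j | k < j ∧ j ≤ b}, {y | ∀ i, y i ≠ j}ᶜ
  have hS : MeasurableSet S := (measurableSet_forall_ne k).inter
    (MeasurableSet.biInter (Set.to_countable _) fun j _ => (measurableSet_forall_ne j).compl)
  have h1 : P (lastSkipped X b k) ≤ P (passThen X Set.univ k S) := by
    refine measure_mono_ae ?_
    filter_upwards [hX.ae_legal, hX.ae_unbounded hp, h0] with ω hleg hunb hω
    rintro ⟨g1, g2⟩
    obtain ⟨t, g3, g4⟩ := Set.mem_iUnion.1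
      ((skipped_iff_passThen hleg hunb (show X 0 ω < k by omega)).1 g1)
    refine Set.mem_iUnion.2 ⟨t, g3, g4, Set.mem_iInter₂.2 fun j hj h5 => g2 j hj.1 hj.2 ?_⟩
    intro n
    rcases Nat.lt_or_ge t n with hn | hn
    · have := h5 (n - (t + 1))
      simpa [show t + 1 + (n - (t + 1)) = n by omega] using this
    · have h6 : X n ω < k := (g3.1 n hn).2
      have h7 : k < j := hj.1
      omega
  refine h1.trans ((hX.measure_passThen_le hξ hp hlk hl hql hqk h0 hS).trans ?_)
  gcongr 2
  refine measure_mono_ae ?_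
  filter_upwards [hX.ae_legal, hX.ae_unbounded hp, h0] with ω hleg hunb hω hmem
  obtain ⟨t, g1, g2, g3⟩ := Set.mem_iUnion.1 hmem
  have g4 : X (t + 1) ω = k + 1 := g1.2
  have g5 : k ∈ skipped X ω := (skipped_iff_passThen hleg hunb (show X 0 ω < k by omega)).2
    (Set.mem_iUnion.2 ⟨t, ⟨fun i hi => ⟨trivial, (g1.1 i hi).2⟩, g4⟩, g2⟩)
  refine ⟨fun n => ?_, g5, fun j h1 h2 h3 => ?_⟩
  · rcases Nat.lt_or_ge t n with hn | hn
    · have : k < X n ω := hleg.lt_of_ne (s := t + 1) (by simp only [g4]; omega) hn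
        fun i _ _ => g5 i
      omega
    · exact (g1.1 n hn).1
  · exact Set.mem_iInter₂.1 g3 j ⟨h1, h2⟩ fun i => h3 _

theorem IsWalk.measure_lastSkipped_mul_log_le [IsFiniteMeasure P] (hX : IsWalk P p X)
    (hξ : IsTailSolution p ξ) (hp : ∀ n, 1 ≤ n → 1 / 3 ≤ p n ∧ p n < 1)
    (hU : ∀ n, 1 ≤ n → 1 / ξ n ≤ 1) {K a b k : ℕ} (hq : ∀ n, K ≤ n + 2 → p n ≤ 2 / 3)
    (h0 : ∀ᵐ ω ∂P, X 0 ω < K) (haK : K ≤ a) (ha : 25 ≤ a) (hk : 2 * a < k) (hkb : k ≤ b) :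
    P (lastSkipped X b k) * ENNReal.ofReal (Real.log a / 2) ≤
      784 * ∑ l ∈ Finset.Ioc a b, P ({ω | l ∈ skipped X ω} ∩ lastSkipped X b k) := by
  have hterm : ∀ l ∈ Finset.Ioc a (k - 4), P (lastSkipped X b k) *
      ENNReal.ofReal (1 / ((k : ℝ) + 1 - l)) ≤
        784 * P ({ω | l ∈ skipped X ω} ∩ lastSkipped X b k) := by
    intro l hl
    rw [Finset.mem_Ioc] at hl
    have h1 := hX.measure_lastSkipped_le hξ hp (b := b) (k := k) (l := l) (by omega) (by omega)
      (hq _ (by omega)) (hq _ (by omega))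
      (by filter_upwards [h0] with ω hω; omega)
    have hpos : (0 : ℝ) < (k : ℝ) + 1 - l := by
      have : (l : ℝ) ≤ k := by exact_mod_cast (by omega : l ≤ k)
      linarith
    have h2 : DFin ξ l (k + 1) ≤ (k : ℝ) + 1 - l := by
      have := hξ.DFin_le_sub hU (show l ≤ k + 1 by omega)
      push_cast at this
      exact this
    calc _ ≤ 784 * (ENNReal.ofReal ((k : ℝ) + 1 - l) *
          P ({ω | l ∈ skipped X ω} ∩ lastSkipped X b k)) *
          ENNReal.ofReal (1 / ((k : ℝ) + 1 - l)) := by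
          refine mul_le_mul' (h1.trans ?_) le_rfl
          gcongr
      _ = 784 * P ({ω | l ∈ skipped X ω} ∩ lastSkipped X b k) *
          (ENNReal.ofReal ((k : ℝ) + 1 - l) * ENNReal.ofReal (1 / ((k : ℝ) + 1 - l))) := by ring
      _ = _ := by
          rw [← ENNReal.ofReal_mul hpos.le, mul_one_div_cancel hpos.ne', ENNReal.ofReal_one, mul_one]
  calc _ ≤ P (lastSkipped X b k) *
        ENNReal.ofReal (∑ l ∈ Finset.Ioc a (k - 4), 1 / ((k : ℝ) + 1 - l)) := by
        gcongr
        exact half_log_le_sum ha hk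
    _ = ∑ l ∈ Finset.Ioc a (k - 4), P (lastSkipped X b k) *
        ENNReal.ofReal (1 / ((k : ℝ) + 1 - l)) := by
        rw [ENNReal.ofReal_sum_of_nonneg, Finset.mul_sum]
        intro l hl
        rw [Finset.mem_Ioc] at hl
        have : (l : ℝ) ≤ k := by exact_mod_cast (by omega : l ≤ k)
        exact div_nonneg zero_le_one (by linarith)
    _ ≤ ∑ l ∈ Finset.Ioc a (k - 4), 784 * P ({ω | l ∈ skipped X ω} ∩ lastSkipped X b k) :=
        Finset.sum_le_sum hterm
    _ ≤ ∑ l ∈ Finset.Ioc a b, 784 * P ({ω | l ∈ skipped X ω} ∩ lastSkipped X b k) :=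
        Finset.sum_le_sum_of_subset (Finset.Ioc_subset_Ioc_right (by omega))
    _ = _ := by rw [Finset.mul_sum]

/-- Some point of `(2a, 4a]` is skipped. -/
def skipBlock {Ω : Type*} (X : ℕ → Ω → ℕ) (a : ℕ) : Set Ω :=
  {ω | ∃ k, 2 * a < k ∧ k ≤ 4 * a ∧ k ∈ skipped X ω}

/-- Sum over the position k of the last skipped point. The events `lastSkipped` are disjoint, so the
right-hand sides add up to at most the expected number of skipped points in (a, 4a]. -/
theorem IsWalk.measure_skipBlock_mul_log_le [IsFiniteMeasure P] (hX : IsWalk P p X)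
    (hξ : IsTailSolution p ξ) (hp : ∀ n, 1 ≤ n → 1 / 3 ≤ p n ∧ p n < 1)
    (hU : ∀ n, 1 ≤ n → 1 / ξ n ≤ 1) {K a : ℕ} (hq : ∀ n, K ≤ n + 2 → p n ≤ 2 / 3)
    (h0 : ∀ᵐ ω ∂P, X 0 ω < K) (haK : K ≤ a) (ha : 25 ≤ a) :
    P (skipBlock X a) * ENNReal.ofReal (Real.log a / 2) ≤
      784 * ∑ l ∈ Finset.Ioc a (4 * a), P Set.univ / D ξ l := by
  have hsub : skipBlock X a ⊆ ⋃ k ∈ Finset.Ioc (2 * a) (4 * a), lastSkipped X (4 * a) k := by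
    rintro ω ⟨k, h1, h2, h3⟩
    classical
    set s := (Finset.Ioc (2 * a) (4 * a)).filter fun k => k ∈ skipped X ω with hs
    have hne : s.Nonempty := ⟨k, by simp [hs, h1, h2, h3]⟩
    have hmem := Finset.mem_filter.1 (s.max'_mem hne)
    refine Set.mem_iUnion₂.2 ⟨s.max' hne, hmem.1, hmem.2, fun j h4 h5 h6 => ?_⟩
    have : j ≤ s.max' hne := s.le_max' j (by
      have := Finset.mem_Ioc.1 hmem.1
      simp only [hs, Finset.mem_filter, Finset.mem_Ioc]
      exact ⟨⟨by omega, h5⟩, h6⟩)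
    omega
  calc _ ≤ (∑ k ∈ Finset.Ioc (2 * a) (4 * a), P (lastSkipped X (4 * a) k)) *
        ENNReal.ofReal (Real.log a / 2) := by
        gcongr
        exact (measure_mono hsub).trans (measure_biUnion_finset_le _ _)
    _ = ∑ k ∈ Finset.Ioc (2 * a) (4 * a), P (lastSkipped X (4 * a) k) *
        ENNReal.ofReal (Real.log a / 2) := by rw [Finset.sum_mul]
    _ ≤ ∑ k ∈ Finset.Ioc (2 * a) (4 * a), 784 * ∑ l ∈ Finset.Ioc a (4 * a),
        P ({ω | l ∈ skipped X ω} ∩ lastSkipped X (4 * a) k) := by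
        refine Finset.sum_le_sum fun k hk => ?_
        rw [Finset.mem_Ioc] at hk
        exact hX.measure_lastSkipped_mul_log_le hξ hp hU hq h0 haK ha hk.1 hk.2
    _ = 784 * ∑ l ∈ Finset.Ioc a (4 * a), ∑ k ∈ Finset.Ioc (2 * a) (4 * a),
        P ({ω | l ∈ skipped X ω} ∩ lastSkipped X (4 * a) k) := by
        rw [← Finset.mul_sum, Finset.sum_comm]
    _ ≤ _ := by
        gcongr with l hl
        rw [Finset.mem_Ioc] at hl
        rw [← measure_biUnion_finset]
        · refine (measure_mono (Set.iUnion₂_subset fun k _ => Set.inter_subset_left)).trans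
            (hX.measure_skipped_le hξ hp ?_)
          filter_upwards [h0] with ω hω
          omega
        · intro k hk k' hk' hne
          exact (lastSkipped_disjoint X (Finset.mem_Ioc.1 hk).2 (Finset.mem_Ioc.1 hk').2 hne).mono
            Set.inter_subset_right Set.inter_subset_right
        · exact fun k _ => (hX.measurableSet_skipped l).inter (measurableSet_lastSkipped hX _ k)

/-- The summand of `critSum`. -/
noncomputable def critTerm (ξ : ℕ → ℝ) (n : ℕ) : ℝ≥0∞ :=
  1 / (D ξ n * ENNReal.ofReal (Real.log (n : ℝ)))

theorem sum_critTerm_le (ξ : ℕ → ℝ) (a b : ℕ) (ha : 1 ≤ a) :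
    ∑ l ∈ Finset.Ioc a b, critTerm ξ l ≤ critSum ξ := by
  calc _ ≤ ∑ l ∈ Finset.Ico 2 (b + 1), critTerm ξ l := by
        refine Finset.sum_le_sum_of_subset fun l hl => ?_
        simp only [Finset.mem_Ioc, Finset.mem_Ico] at *
        omega
    _ = ∑ i ∈ Finset.range (b + 1 - 2), critTerm ξ (i + 2) := by
        rw [Finset.sum_Ico_eq_sum_range]
        simp_rw [add_comm 2]
    _ ≤ _ := ENNReal.sum_le_tsum (f := fun i => critTerm ξ (i + 2)) _

theorem tsum_dyadic_critTerm_le (ξ : ℕ → ℝ) (i : ℕ) :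
    ∑' j, ∑ l ∈ Finset.Ioc (2 ^ (i + j)) (2 ^ (i + j + 1)), critTerm ξ l ≤ critSum ξ := by
  rw [ENNReal.tsum_eq_iSup_nat]
  refine iSup_le fun J => ?_
  have : ∑ j ∈ Finset.range J, ∑ l ∈ Finset.Ioc (2 ^ (i + j)) (2 ^ (i + j + 1)), critTerm ξ l =
      ∑ l ∈ Finset.Ioc (2 ^ i) (2 ^ (i + J)), critTerm ξ l := by
    induction J with
    | zero => simp
    | succ J ih =>
      rw [Finset.sum_range_succ, ih, Finset.sum_Ioc_consecutive _
        (Nat.pow_le_pow_right (by norm_num) (by omega))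
        (Nat.pow_le_pow_right (by norm_num) (by omega))]
      rfl
  rw [this]
  exact sum_critTerm_le ξ _ _ Nat.one_le_two_pow

/-- For l ≤ 4a ≤ a ^ 2 one has log l ≤ 2 log a, four times the factor log a / 2; hence 3136 = 4 ·
784. -/
theorem IsWalk.measure_skipBlock_le [IsFiniteMeasure P] (hX : IsWalk P p X)
    (hξ : IsTailSolution p ξ) (hp : ∀ n, 1 ≤ n → 1 / 3 ≤ p n ∧ p n < 1)
    (hU : ∀ n, 1 ≤ n → 1 / ξ n ≤ 1) {K a : ℕ} (hq : ∀ n, K ≤ n + 2 → p n ≤ 2 / 3)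
    (h0 : ∀ᵐ ω ∂P, X 0 ω < K) (haK : K ≤ a) (ha : 25 ≤ a) :
    P (skipBlock X a) ≤ 3136 * P Set.univ * ∑ l ∈ Finset.Ioc a (4 * a), critTerm ξ l := by
  have h := hX.measure_skipBlock_mul_log_le hξ hp hU hq h0 haK ha
  have ha' : (25 : ℝ) ≤ a := by exact_mod_cast ha
  have hlog : 0 < Real.log a := Real.log_pos (by linarith)
  set L := ENNReal.ofReal (Real.log a / 2) with hL
  have hL0 : L ≠ 0 := by
    rw [hL, Ne, ENNReal.ofReal_eq_zero]
    linarith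
  have hLt : L ≠ ∞ := ENNReal.ofReal_ne_top
  rw [← ENNReal.mul_le_mul_iff_left hL0 hLt]
  refine h.trans ?_
  rw [mul_assoc 3136, mul_assoc 3136, mul_assoc, Finset.sum_mul, Finset.mul_sum, Finset.mul_sum,
    Finset.mul_sum]
  refine Finset.sum_le_sum fun l hl => ?_
  rw [Finset.mem_Ioc] at hl
  have hl1 : (a : ℝ) < l := by exact_mod_cast hl.1
  have hl2 : (l : ℝ) ≤ 4 * a := by exact_mod_cast hl.2
  have hll : ENNReal.ofReal (Real.log l) ≤ 4 * L := by
    have : (4 : ℝ≥0∞) * L = ENNReal.ofReal (2 * Real.log a) := by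
      rw [hL, show (4 : ℝ≥0∞) = ENNReal.ofReal 4 by norm_num, ← ENNReal.ofReal_mul (by norm_num)]
      congr 1
      ring
    rw [this]
    refine ENNReal.ofReal_le_ofReal ?_
    rw [two_mul, ← Real.log_mul (by linarith) (by linarith)]
    exact Real.log_le_log (by linarith) (by nlinarith)
  have hl0 : ENNReal.ofReal (Real.log l) ≠ 0 := by
    rw [Ne, ENNReal.ofReal_eq_zero, not_le]
    exact Real.log_pos (by linarith)
  have hD0 : D ξ l ≠ 0 := (lt_of_lt_of_le zero_lt_one (one_le_D ξ l)).ne'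
  have key : (1 : ℝ≥0∞) ≤ 4 * L * (ENNReal.ofReal (Real.log l))⁻¹ := by
    rw [← ENNReal.mul_inv_cancel hl0 ENNReal.ofReal_ne_top]
    gcongr
  rw [critTerm, one_div, ENNReal.mul_inv (Or.inl hD0) (Or.inr hl0), div_eq_mul_inv]
  calc 784 * (P Set.univ * (D ξ l)⁻¹) = 784 * (P Set.univ * (D ξ l)⁻¹) * 1 := (mul_one _).symm
    _ ≤ 784 * (P Set.univ * (D ξ l)⁻¹) * (4 * L * (ENNReal.ofReal (Real.log l))⁻¹) := by gcongr
    _ = _ := by ring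

theorem exists_dyadic {k : ℕ} (hk : 2 ≤ k) : ∃ j, 2 * 2 ^ j < k + 1 ∧ k + 1 ≤ 4 * 2 ^ j := by
  refine ⟨Nat.log 2 k - 1, ?_, ?_⟩
  · rw [← pow_succ', Nat.sub_add_cancel (Nat.log_pos (by norm_num) hk)]
    exact Nat.lt_succ_of_le (Nat.pow_log_le_self 2 (by omega))
  · rw [show 4 = 2 ^ 2 by norm_num, ← pow_add]
    have := Nat.log_pos (b := 2) (by norm_num) hk
    rw [show 2 + (Nat.log 2 k - 1) = Nat.log 2 k + 1 by omega]
    exact Nat.lt_pow_succ_log_self (by norm_num) k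

theorem IsWalk.ae_finite_skipped_of_start [IsFiniteMeasure P] (hX : IsWalk P p X)
    (hξ : IsTailSolution p ξ) (hp : ∀ n, 1 ≤ n → 1 / 3 ≤ p n ∧ p n < 1)
    (hU : ∀ n, 1 ≤ n → 1 / ξ n ≤ 1) {K : ℕ} (hK : 25 ≤ K) (hq : ∀ n, K ≤ n + 2 → p n ≤ 2 / 3)
    (h0 : ∀ᵐ ω ∂P, X 0 ω < K) (hcrit : critSum ξ < ∞) : ∀ᵐ ω ∂P, (skipped X ω).Finite := by
  have hKpow : ∀ j, K ≤ 2 ^ (K + j) := fun j =>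
    (Nat.lt_two_pow_self).le.trans (Nat.pow_le_pow_right (by norm_num) (by omega))
  have hsum : ∑' j, P (skipBlock X (2 ^ (K + j))) ≠ ∞ := by
    refine ne_top_of_le_ne_top (b := 3136 * P Set.univ * (critSum ξ + critSum ξ)) ?_ ?_
    · exact ENNReal.mul_ne_top (ENNReal.mul_ne_top (by norm_num) (measure_ne_top _ _))
        (ENNReal.add_ne_top.2 ⟨hcrit.ne, hcrit.ne⟩)
    -- With a = 2 ^ (K + j), the interval (a, 4a] consists of two dyadic blocks, so each term of
    -- `critSum` is used at most twice.
    · calc _ ≤ ∑' j, 3136 * P Set.univ *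
            (∑ l ∈ Finset.Ioc (2 ^ (K + j)) (2 ^ (K + j + 1)), critTerm ξ l +
              ∑ l ∈ Finset.Ioc (2 ^ (K + 1 + j)) (2 ^ (K + 1 + j + 1)), critTerm ξ l) := by
            refine ENNReal.tsum_le_tsum fun j => ?_
            refine (hX.measure_skipBlock_le hξ hp hU hq h0 (hKpow j)
              (hK.trans (hKpow j))).trans (le_of_eq ?_)
            rw [show K + 1 + j = K + j + 1 by omega, Finset.sum_Ioc_consecutive _
              (Nat.pow_le_pow_right (by norm_num) (by omega))
              (Nat.pow_le_pow_right (by norm_num) (by omega))]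
            congr 3
            ring
        _ ≤ _ := by
            rw [ENNReal.tsum_mul_left, ENNReal.tsum_add]
            gcongr
            · exact tsum_dyadic_critTerm_le ξ K
            · exact tsum_dyadic_critTerm_le ξ (K + 1)
  have hBC := ae_eventually_notMem hsum
  filter_upwards [hBC] with ω hω
  obtain ⟨J, hJ⟩ := eventually_atTop.1 hω
  refine (Set.finite_Iic (4 * 2 ^ (K + J))).subset fun k hk => ?_
  by_contra hcon
  have hcon' : 4 * 2 ^ (K + J) < k := not_le.1 hcon
  have h2 : 1 ≤ 2 ^ (K + J) := Nat.one_le_two_pow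
  obtain ⟨j, hj1, hj2⟩ := exists_dyadic (k := k - 1) (by omega)
  rw [Nat.sub_add_cancel (by omega)] at hj1 hj2
  have hlt : K + J < j := by
    by_contra hc
    have : 2 ^ j ≤ 2 ^ (K + J) := Nat.pow_le_pow_right (by norm_num) (not_lt.1 hc)
    omega
  refine hJ (j - K) (by omega) ⟨k, ?_, ?_, hk⟩
  · rwa [show K + (j - K) = j by omega]
  · rwa [show K + (j - K) = j by omega]

/-- If `critSum ξ` is finite, almost surely there are only finitely many skipped points. -/
theorem IsWalk.ae_finite_skipped [IsFiniteMeasure P] (hX : IsWalk P p X)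
    (hξ : IsTailSolution p ξ) (hp : ∀ n, 1 ≤ n → 1 / 3 ≤ p n ∧ p n < 1)
    (hU : ∀ n, 1 ≤ n → 1 / ξ n ≤ 1) (hq : ∀ᶠ n in atTop, p n ≤ 2 / 3)
    (hcrit : critSum ξ < ∞) : ∀ᵐ ω ∂P, (skipped X ω).Finite := by
  obtain ⟨N, hN⟩ := eventually_atTop.1 hq
  -- The initial law may have unbounded support, so the starting point is fixed before the threshold
  -- K is chosen above it.
  have h : ∀ x, ∀ᵐ ω ∂P, X 0 ω = x → (skipped X ω).Finite := by
    intro x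
    have hC : Past X 0 {ω | X 0 ω ∈ ({x} : Set ℕ)} := past_preimage X le_rfl {x}
    have hm := hC.measurableSet hX.measurable
    have hw := hX.shift hC
    simp only [zero_add] at hw
    have hx : ∀ᵐ ω ∂(P.restrict {ω | X 0 ω ∈ ({x} : Set ℕ)}), X 0 ω < N + x + 25 := by
      rw [ae_restrict_iff' hm]
      refine Eventually.of_forall fun ω hω => ?_
      have : X 0 ω = x := hω
      omega
    have := hw.ae_finite_skipped_of_start hξ hp hU (K := N + x + 25) (by omega)
      (fun n hn => hN n (by omega)) hx hcrit
    rwa [ae_restrict_iff' hm] at this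
  filter_upwards [ae_all_iff.2 h] with ω hω using hω _ rfl

end SkipWalk

/-! ### Part (ii): second moment of the weighted count and Lévy's 0-1 law. -/

namespace SkipWalk

theorem sub_div_le_two_mul_log_sub {a b : ℝ} (ha : 0 < a) (hab : a ≤ b) (hb : b ≤ 2 * a) :
    (b - a) / a ≤ 2 * (Real.log b - Real.log a) := by
  have hb0 : 0 < b := ha.trans_le hab
  have h1 := Real.one_sub_inv_le_log_of_pos (div_pos hb0 ha)
  rw [Real.log_div hb0.ne' ha.ne', inv_div] at h1
  refine le_trans ?_ (mul_le_mul_of_nonneg_left h1 zero_le_two)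
  rw [div_le_iff₀ ha]
  have : 2 * (1 - a / b) * a - (b - a) = (b - a) * (2 * a - b) / b := by
    field_simp
  have h2 : 0 ≤ (b - a) * (2 * a - b) / b :=
    div_nonneg (mul_nonneg (by linarith) (by linarith)) hb0.le
  linarith

/-- The product is the increment of `DFin ξ k` from l to l + 1, so the sum is a Riemann sum of dx /
x. Increments are at most 1 ≤ `DFin ξ k l`, so each step at most doubles, which costs only the
factor 2. -/
theorem IsTailSolution.sum_prod_div_le {p ξ : ℕ → ℝ} (hξ : IsTailSolution p ξ)
    (hU : ∀ n, 1 ≤ n → 1 / ξ n ≤ 1) {k n : ℕ} (hkn : k + 1 ≤ n) :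
    ∑ l ∈ Finset.Ico (k + 1) n, (∏ i ∈ Finset.Ico (k + 1) (l + 1), 1 / ξ i) / DFin ξ k l ≤
      2 * Real.log (DFin ξ k n) := by
  induction n, hkn using Nat.le_induction with
  | base => simp [DFin_self_succ]
  | succ n hn ih =>
    rw [Finset.sum_Ico_succ_top hn]
    have h1 := DFin_succ ξ (show k ≤ n by omega)
    have h2 := hξ.one_le_DFin (show k < n by omega)
    have h3 := hξ.prod_pos k (n + 1)
    have h4 := hξ.prod_le_one hU k (n + 1)
    have := sub_div_le_two_mul_log_sub (a := DFin ξ k n) (b := DFin ξ k (n + 1)) (by linarith)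
      (by linarith) (by linarith)
    rw [show DFin ξ k (n + 1) - DFin ξ k n = ∏ i ∈ Finset.Ico (k + 1) (n + 1), 1 / ξ i by
      linarith] at this
    linarith

theorem one_le_toReal_D {ξ : ℕ → ℝ} {k : ℕ} (hk : D ξ k ≠ ∞) : 1 ≤ (D ξ k).toReal := by
  rw [← ENNReal.toReal_one]
  exact ENNReal.toReal_mono hk (one_le_D ξ k)

theorem IsTailSolution.DFin_le_toReal_D {p ξ : ℕ → ℝ} (hξ : IsTailSolution p ξ) {k : ℕ}
    (hk : D ξ k ≠ ∞) (n : ℕ) : DFin ξ k n ≤ (D ξ k).toReal := by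
  rw [← ENNReal.toReal_ofReal (hξ.DFin_nonneg k n)]
  exact ENNReal.toReal_mono hk (DFin_le_D ξ k n)

variable {Ω : Type*} [MeasurableSpace Ω] {P : Measure Ω} {p ξ : ℕ → ℝ} {X : ℕ → Ω → ℕ}

/-- The number of skipped points in `[K, n)`, with weights `1 / log k`. -/
noncomputable def weightedCount {Ω : Type*} (X : ℕ → Ω → ℕ) (K n : ℕ) (ω : Ω) : ℝ :=
  ∑ k ∈ Finset.Ico K n, {ω | k ∈ skipped X ω}.indicator (fun _ => 1 / Real.log k) ω

theorem IsWalk.measurable_weightedCount (hX : IsWalk P p X) (K n : ℕ) :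
    Measurable (weightedCount X K n) :=
  Finset.measurable_sum _ fun k _ => measurable_const.indicator (hX.measurableSet_skipped k)

section Moments

variable [IsFiniteMeasure P]

theorem IsWalk.real_skipped_le (hX : IsWalk P p X) (hξ : IsTailSolution p ξ)
    (hp : ∀ n, 1 ≤ n → 1 / 3 ≤ p n ∧ p n < 1) {k : ℕ} (h0 : ∀ᵐ ω ∂P, X 0 ω < k) :
    P.real {ω | k ∈ skipped X ω} ≤ P.real Set.univ / (D ξ k).toReal := by
  have h := hX.measure_skipped_le hξ hp h0
  have hD0 : D ξ k ≠ 0 := (lt_of_lt_of_le zero_lt_one (one_le_D ξ k)).ne'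
  rw [measureReal_def, measureReal_def, ← ENNReal.toReal_div]
  exact ENNReal.toReal_mono (ENNReal.div_ne_top (measure_ne_top _ _) hD0) h

theorem IsWalk.le_real_skipped (hX : IsWalk P p X) (hξ : IsTailSolution p ξ)
    (hp : ∀ n, 1 ≤ n → 1 / 3 ≤ p n ∧ p n < 1) {k : ℕ} (hk : 4 ≤ k) (hq : p (k - 2) ≤ 2 / 3)
    (h0 : ∀ᵐ ω ∂P, X 0 ω < k) :
    P.real Set.univ / (D ξ k).toReal ≤ 28 * P.real {ω | k ∈ skipped X ω} := by
  have h := ENNReal.toReal_mono (ENNReal.mul_ne_top (by norm_num) (measure_ne_top _ _))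
    (hX.le_measure_skipped hξ hp hk hq h0)
  rw [ENNReal.toReal_div, ENNReal.toReal_mul] at h
  simpa [measureReal_def] using h

/-- `D_add` splits 1 / (D(k, l) D(l)) into the value expected under independence and a correction to
be summed over l. -/
theorem IsWalk.real_skipped_inter_le (hX : IsWalk P p X) (hξ : IsTailSolution p ξ)
    (hp : ∀ n, 1 ≤ n → 1 / 3 ≤ p n ∧ p n < 1) {k l : ℕ} (hkl : k < l) (h0 : ∀ᵐ ω ∂P, X 0 ω < k)
    (hk : D ξ k ≠ ∞) (hl : D ξ l ≠ ∞) :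
    P.real ({ω | k ∈ skipped X ω} ∩ {ω | l ∈ skipped X ω}) ≤ P.real Set.univ *
      (1 / (D ξ k).toReal * (1 / (D ξ l).toReal) + 1 / (D ξ k).toReal *
        ((∏ i ∈ Finset.Ico (k + 1) (l + 1), 1 / ξ i) / DFin ξ k l)) := by
  have hD0 : D ξ l ≠ 0 := (lt_of_lt_of_le zero_lt_one (one_le_D ξ l)).ne'
  have h := ENNReal.toReal_mono (ENNReal.div_ne_top (measure_ne_top _ _) hD0)
    (hX.measure_skipped_inter_le hξ hp hkl h0)
  rw [ENNReal.toReal_div, ENNReal.toReal_mul, ENNReal.toReal_ofReal (hξ.DFin_nonneg k l),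
    ← measureReal_def, ← measureReal_def] at h
  have hh := hξ.one_le_DFin hkl
  have hDk := one_le_toReal_D hk
  have hDl := one_le_toReal_D hl
  have hadd := hξ.D_add hkl.le hk hl
  set h' := DFin ξ k l
  set dk := (D ξ k).toReal
  set dl := (D ξ l).toReal
  set π := ∏ i ∈ Finset.Ico (k + 1) (l + 1), 1 / ξ i
  have e : 1 / dk * (1 / dl) + 1 / dk * (π / h') = 1 / (h' * dl) := by
    have : h' ≠ 0 := by linarith
    have : dk ≠ 0 := by linarith
    have : dl ≠ 0 := by linarith
    field_simp
    linarith
  rw [e, mul_one_div, le_div_iff₀ (mul_pos (by linarith) (by linarith))]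
  rw [le_div_iff₀ (by linarith)] at h
  linarith

/-- `1 / (D(k) log k)` as a real number. -/
noncomputable def critReal (ξ : ℕ → ℝ) (k : ℕ) : ℝ := 1 / Real.log k * (1 / (D ξ k).toReal)

/-- The off-diagonal correction in the second moment of the weighted number of skipped points. -/
noncomputable def pairTerm (ξ : ℕ → ℝ) (k l : ℕ) : ℝ :=
  if k < l then 1 / Real.log k * (1 / Real.log l) * (1 / (D ξ k).toReal *
    ((∏ i ∈ Finset.Ico (k + 1) (l + 1), 1 / ξ i) / DFin ξ k l)) else 0

theorem one_le_log {k : ℕ} (hk : 4 ≤ k) : 1 ≤ Real.log k := by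
  have h1 : Real.exp 1 ≤ k := by
    have := Real.exp_one_lt_d9
    have h2 : (4 : ℝ) ≤ k := by exact_mod_cast hk
    linarith
  rw [← Real.log_exp 1]
  exact Real.log_le_log (Real.exp_pos 1) h1

theorem critReal_nonneg (ξ : ℕ → ℝ) {k : ℕ} (hk : 4 ≤ k) : 0 ≤ critReal ξ k :=
  mul_nonneg (one_div_nonneg.2 (by linarith [one_le_log hk]))
    (one_div_nonneg.2 ENNReal.toReal_nonneg)

theorem IsTailSolution.pairTerm_nonneg (hξ : IsTailSolution p ξ) {k l : ℕ} (hk : 4 ≤ k)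
    (hl : 4 ≤ l) : 0 ≤ pairTerm ξ k l := by
  rw [pairTerm]
  split_ifs
  · have h1 := one_le_log hk
    have h2 := one_le_log hl
    have h3 := (hξ.prod_pos k (l + 1)).le
    have h4 := hξ.DFin_nonneg k l
    have h5 : 0 ≤ (D ξ k).toReal := ENNReal.toReal_nonneg
    positivity
  · exact le_rfl

/-- The reason for the weights: the corrections sum to at most 2 log D(k) ≤ 6 log k times 1 / D(k),
and the weight 1 / log l ≤ 1 / log k cancels that logarithm. -/
theorem IsTailSolution.sum_pairTerm_le (hξ : IsTailSolution p ξ) (hU : ∀ n, 1 ≤ n → 1 / ξ n ≤ 1)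
    {K n k : ℕ} (hK : 4 ≤ K) (hKk : K ≤ k) (hkn : k < n) (hD : D ξ k ≠ ∞)
    (hlog : Real.log (D ξ k).toReal ≤ 3 * Real.log k) :
    ∑ l ∈ Finset.Ico K n, pairTerm ξ k l ≤ 6 * critReal ξ k := by
  have hk1 := one_le_log (hK.trans hKk)
  have hDk := one_le_toReal_D hD
  have h1 : ∑ l ∈ Finset.Ico K n, pairTerm ξ k l = ∑ l ∈ Finset.Ico (k + 1) n, pairTerm ξ k l := by
    symm
    refine Finset.sum_subset (Finset.Ico_subset_Ico_left (by omega)) fun l hl hl' => ?_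
    rw [Finset.mem_Ico] at hl hl'
    rw [pairTerm, if_neg (by omega)]
  rw [h1]
  have h2 : ∀ l ∈ Finset.Ico (k + 1) n, pairTerm ξ k l ≤ (1 / Real.log k * (1 / Real.log k) *
      (1 / (D ξ k).toReal)) *
        ((∏ i ∈ Finset.Ico (k + 1) (l + 1), 1 / ξ i) / DFin ξ k l) := by
    intro l hl
    rw [Finset.mem_Ico] at hl
    rw [pairTerm, if_pos (by omega), ← mul_assoc]
    have h3 := (hξ.prod_pos k (l + 1)).le
    have h4 := hξ.DFin_nonneg k l
    have h5 : Real.log k ≤ Real.log l :=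
      Real.log_le_log (by exact_mod_cast (by omega : 0 < k)) (by exact_mod_cast (by omega : k ≤ l))
    gcongr
  refine (Finset.sum_le_sum h2).trans ?_
  rw [← Finset.mul_sum]
  have h6 := hξ.sum_prod_div_le hU (show k + 1 ≤ n by omega)
  have h7 : Real.log (DFin ξ k n) ≤ Real.log (D ξ k).toReal :=
    Real.log_le_log (by linarith [hξ.one_le_DFin hkn]) (hξ.DFin_le_toReal_D hD n)
  calc _ ≤ (1 / Real.log k * (1 / Real.log k) * (1 / (D ξ k).toReal)) * (6 * Real.log k) := by
        gcongr
        linarith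
    _ = _ := by
        rw [critReal]
        have : Real.log k ≠ 0 := by linarith
        field_simp

/-- Here 13 = 6 + 6 + 1: the corrections for k < l, those for l < k, and the diagonal. -/
theorem IsWalk.sum_sum_real_skipped_le (hX : IsWalk P p X) (hξ : IsTailSolution p ξ)
    (hp : ∀ n, 1 ≤ n → 1 / 3 ≤ p n ∧ p n < 1) (hU : ∀ n, 1 ≤ n → 1 / ξ n ≤ 1) {K : ℕ}
    (hK : 4 ≤ K) (h0 : ∀ᵐ ω ∂P, X 0 ω < K) (hD : ∀ k, K ≤ k → D ξ k ≠ ∞)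
    (hlog : ∀ k, K ≤ k → Real.log (D ξ k).toReal ≤ 3 * Real.log k) (n : ℕ) :
    ∑ k ∈ Finset.Ico K n, ∑ l ∈ Finset.Ico K n, 1 / Real.log k * (1 / Real.log l) *
      P.real ({ω | k ∈ skipped X ω} ∩ {ω | l ∈ skipped X ω}) ≤
    P.real Set.univ * ((∑ k ∈ Finset.Ico K n, critReal ξ k) ^ 2 +
      13 * ∑ k ∈ Finset.Ico K n, critReal ξ k) := by
  set M := P.real Set.univ
  have hM : 0 ≤ M := measureReal_nonneg
  have hlt : ∀ k, K ≤ k → ∀ᵐ ω ∂P, X 0 ω < k := fun k hk => by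
    filter_upwards [h0] with ω hω using by omega
  have off : ∀ k l, K ≤ k → k < l → 1 / Real.log k * (1 / Real.log l) *
      P.real ({ω | k ∈ skipped X ω} ∩ {ω | l ∈ skipped X ω}) ≤
      M * (critReal ξ k * critReal ξ l + pairTerm ξ k l) := by
    intro k l hk hkl
    have h1 := one_le_log (hK.trans hk)
    have h2 := one_le_log (show 4 ≤ l by omega)
    have h3 := hX.real_skipped_inter_le hξ hp hkl (hlt k hk) (hD k hk) (hD l (by omega))
    refine (mul_le_mul_of_nonneg_left h3 (by positivity)).trans (le_of_eq ?_)
    rw [pairTerm, if_pos hkl, critReal, critReal]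
    ring
  have key : ∀ k ∈ Finset.Ico K n, ∀ l ∈ Finset.Ico K n, 1 / Real.log k * (1 / Real.log l) *
      P.real ({ω | k ∈ skipped X ω} ∩ {ω | l ∈ skipped X ω}) ≤
      M * (critReal ξ k * critReal ξ l + pairTerm ξ k l + pairTerm ξ l k +
        if k = l then critReal ξ k else 0) := by
    intro k hk l hl
    rw [Finset.mem_Ico] at hk hl
    have ck := critReal_nonneg ξ (hK.trans hk.1)
    have cl := critReal_nonneg ξ (hK.trans hl.1)
    have p1 := hξ.pairTerm_nonneg (hK.trans hk.1) (hK.trans hl.1)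
    have p2 := hξ.pairTerm_nonneg (hK.trans hl.1) (hK.trans hk.1)
    rcases lt_trichotomy k l with h | rfl | h
    · refine (off k l hk.1 h).trans (mul_le_mul_of_nonneg_left ?_ hM)
      rw [if_neg h.ne]
      linarith
    · rw [Set.inter_self, if_pos rfl]
      have h1 := one_le_log (hK.trans hk.1)
      have h2 := hX.real_skipped_le hξ hp (hlt k hk.1)
      have h3 : 1 / Real.log k ≤ 1 := by
        rw [div_le_one (by linarith)]
        exact h1
      calc _ ≤ 1 / Real.log k * 1 * (M / (D ξ k).toReal) := by gcongr
        _ = M * critReal ξ k := by rw [critReal]; ring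
        _ ≤ _ := by
          refine mul_le_mul_of_nonneg_left ?_ hM
          have := mul_nonneg ck ck
          linarith
    · rw [Set.inter_comm, mul_comm (1 / Real.log k)]
      refine (off l k hl.1 h).trans (mul_le_mul_of_nonneg_left ?_ hM)
      rw [if_neg h.ne']
      linarith
  refine (Finset.sum_le_sum fun k hk => Finset.sum_le_sum fun l hl => key k hk l hl).trans ?_
  simp_rw [← Finset.mul_sum, Finset.sum_add_distrib]
  refine mul_le_mul_of_nonneg_left ?_ hM
  have s1 : ∑ k ∈ Finset.Ico K n, ∑ l ∈ Finset.Ico K n, critReal ξ k * critReal ξ l =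
      (∑ k ∈ Finset.Ico K n, critReal ξ k) ^ 2 := by
    rw [sq, Finset.sum_mul_sum]
  have s2 : ∑ k ∈ Finset.Ico K n, ∑ l ∈ Finset.Ico K n, pairTerm ξ k l ≤
      6 * ∑ k ∈ Finset.Ico K n, critReal ξ k := by
    rw [Finset.mul_sum]
    refine Finset.sum_le_sum fun k hk => ?_
    rw [Finset.mem_Ico] at hk
    exact hξ.sum_pairTerm_le hU hK hk.1 hk.2 (hD k hk.1) (hlog k hk.1)
  have s3 : ∑ k ∈ Finset.Ico K n, ∑ l ∈ Finset.Ico K n, pairTerm ξ l k ≤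
      6 * ∑ k ∈ Finset.Ico K n, critReal ξ k := by
    rw [Finset.sum_comm]
    exact s2
  have s4 : ∑ k ∈ Finset.Ico K n, ∑ l ∈ Finset.Ico K n, (if k = l then critReal ξ k else 0) =
      ∑ k ∈ Finset.Ico K n, critReal ξ k := by
    refine Finset.sum_congr rfl fun k hk => ?_
    rw [Finset.sum_ite_eq, if_pos hk]
  linarith

theorem IsWalk.integrable_weightedCount (hX : IsWalk P p X) (K n : ℕ) :
    Integrable (weightedCount X K n) P :=
  integrable_finsetSum _ fun k _ => (integrable_const _).indicator (hX.measurableSet_skipped k)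

theorem IsWalk.integral_weightedCount (hX : IsWalk P p X) (K n : ℕ) :
    ∫ ω, weightedCount X K n ω ∂P =
      ∑ k ∈ Finset.Ico K n, 1 / Real.log k * P.real {ω | k ∈ skipped X ω} := by
  simp only [weightedCount]
  rw [integral_finsetSum _ fun k _ =>
    (integrable_const _).indicator (hX.measurableSet_skipped k)]
  refine Finset.sum_congr rfl fun k _ => ?_
  rw [integral_indicator_const _ (hX.measurableSet_skipped k), smul_eq_mul, mul_comm]

theorem weightedCount_sq {Ω : Type*} (X : ℕ → Ω → ℕ) (K n : ℕ) (ω : Ω) :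
    weightedCount X K n ω ^ 2 = ∑ k ∈ Finset.Ico K n, ∑ l ∈ Finset.Ico K n,
      ({ω | k ∈ skipped X ω} ∩ {ω | l ∈ skipped X ω}).indicator
        (fun _ => 1 / Real.log k * (1 / Real.log l)) ω := by
  rw [weightedCount, sq, Finset.sum_mul_sum]
  refine Finset.sum_congr rfl fun k _ => Finset.sum_congr rfl fun l _ => ?_
  rw [Set.inter_indicator_mul]

theorem IsWalk.integrable_weightedCount_sq (hX : IsWalk P p X) (K n : ℕ) :
    Integrable (fun ω => weightedCount X K n ω ^ 2) P := by
  simp_rw [weightedCount_sq]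
  exact integrable_finsetSum _ fun k _ => integrable_finsetSum _ fun l _ =>
    (integrable_const _).indicator ((hX.measurableSet_skipped k).inter (hX.measurableSet_skipped l))

theorem IsWalk.integral_weightedCount_sq (hX : IsWalk P p X) (K n : ℕ) :
    ∫ ω, weightedCount X K n ω ^ 2 ∂P =
      ∑ k ∈ Finset.Ico K n, ∑ l ∈ Finset.Ico K n, 1 / Real.log k * (1 / Real.log l) *
        P.real ({ω | k ∈ skipped X ω} ∩ {ω | l ∈ skipped X ω}) := by
  have hi : ∀ k l, Integrable (fun ω => ({ω | k ∈ skipped X ω} ∩ {ω | l ∈ skipped X ω}).indicator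
      (fun _ => 1 / Real.log k * (1 / Real.log l)) ω) P := fun k l =>
    (integrable_const _).indicator ((hX.measurableSet_skipped k).inter (hX.measurableSet_skipped l))
  simp_rw [weightedCount_sq]
  rw [integral_finsetSum _ fun k _ => integrable_finsetSum _ fun l _ => hi k l]
  refine Finset.sum_congr rfl fun k _ => ?_
  rw [integral_finsetSum _ fun l _ => hi k l]
  refine Finset.sum_congr rfl fun l _ => ?_
  rw [integral_indicator_const _ ((hX.measurableSet_skipped k).inter (hX.measurableSet_skipped l)),
    smul_eq_mul, mul_comm]

/-- A second moment bound: if `E Z ≥ M S / 28` and `E Z² ≤ 2 M S²`, where `M` is the total mass, then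
`P(Z ≥ S / 112) ≥ M / 3136`. -/
theorem measureReal_ge_of_moments {Z : Ω → ℝ} (hZm : Measurable Z) (hZ : Integrable Z P)
    (hZ2 : Integrable (fun ω => Z ω ^ 2) P) {S : ℝ} (hS : 0 < S)
    (h1 : P.real Set.univ * S / 28 ≤ ∫ ω, Z ω ∂P)
    (h2 : ∫ ω, Z ω ^ 2 ∂P ≤ 2 * P.real Set.univ * S ^ 2) :
    P.real Set.univ / 3136 ≤ P.real {ω | S / 112 ≤ Z ω} := by
  have hm : MeasurableSet {ω | S / 112 ≤ Z ω} := measurableSet_le measurable_const hZm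
  -- On the event, (Z - 112 S) ^ 2 ≥ 0 gives Z ≤ Z ^ 2 / (224 S) + 56 S. After integration the first
  -- two terms are at most M S / 112 each, so M S / 56 is left for 56 S times the probability.
  have hpt : ∀ ω, Z ω ≤ S / 112 + 1 / (224 * S) * Z ω ^ 2 +
      {ω | S / 112 ≤ Z ω}.indicator (fun _ => 56 * S) ω := by
    intro ω
    have hn : 0 ≤ 1 / (224 * S) * Z ω ^ 2 := by positivity
    by_cases h : S / 112 ≤ Z ω
    · rw [Set.indicator_of_mem (by exact h)]
      have : S / 112 + 1 / (224 * S) * Z ω ^ 2 + 56 * S - Z ω =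
          S / 112 + 1 / (224 * S) * (Z ω - 112 * S) ^ 2 := by
        field_simp
        ring
      have h3 : 0 ≤ S / 112 + 1 / (224 * S) * (Z ω - 112 * S) ^ 2 := by positivity
      linarith
    · rw [Set.indicator_of_notMem (by exact h)]
      linarith [not_le.1 h]
  have hi1 : Integrable (fun ω => S / 112 + 1 / (224 * S) * Z ω ^ 2) P :=
    (integrable_const _).add (hZ2.const_mul _)
  have hi2 : Integrable (fun ω => {ω | S / 112 ≤ Z ω}.indicator (fun _ => 56 * S) ω) P :=
    (integrable_const _).indicator hm
  have hint : ∫ ω, Z ω ∂P ≤ ∫ ω, (S / 112 + 1 / (224 * S) * Z ω ^ 2 +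
      {ω | S / 112 ≤ Z ω}.indicator (fun _ => 56 * S) ω) ∂P :=
    integral_mono hZ (hi1.add hi2) hpt
  rw [integral_add hi1 hi2, integral_add (integrable_const _) (hZ2.const_mul _), integral_const,
    integral_const_mul,
    integral_indicator_const _ hm, smul_eq_mul, smul_eq_mul] at hint
  have h3 : 1 / (224 * S) * ∫ ω, Z ω ^ 2 ∂P ≤ P.real Set.univ * S / 112 := by
    calc _ ≤ 1 / (224 * S) * (2 * P.real Set.univ * S ^ 2) := by gcongr
      _ = _ := by field_simp; ring
  have h4 : P.real Set.univ / 3136 * (56 * S) ≤ P.real {ω | S / 112 ≤ Z ω} * (56 * S) := by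
    linarith
  exact le_of_mul_le_mul_right h4 (by linarith)

theorem IsWalk.measureReal_weightedCount_ge (hX : IsWalk P p X) (hξ : IsTailSolution p ξ)
    (hp : ∀ n, 1 ≤ n → 1 / 3 ≤ p n ∧ p n < 1) (hU : ∀ n, 1 ≤ n → 1 / ξ n ≤ 1) {K : ℕ}
    (hK : 4 ≤ K) (hq : ∀ n, K ≤ n + 2 → p n ≤ 2 / 3) (h0 : ∀ᵐ ω ∂P, X 0 ω < K)
    (hD : ∀ k, K ≤ k → D ξ k ≠ ∞)
    (hlog : ∀ k, K ≤ k → Real.log (D ξ k).toReal ≤ 3 * Real.log k) {n : ℕ}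
    (hS : 13 ≤ ∑ k ∈ Finset.Ico K n, critReal ξ k) :
    P.real Set.univ / 3136 ≤
      P.real {ω | (∑ k ∈ Finset.Ico K n, critReal ξ k) / 112 ≤ weightedCount X K n ω} := by
  refine measureReal_ge_of_moments (hX.measurable_weightedCount K n)
    (hX.integrable_weightedCount K n) (hX.integrable_weightedCount_sq K n) (by linarith) ?_ ?_
  · rw [hX.integral_weightedCount, mul_div_assoc, Finset.sum_div, Finset.mul_sum]
    refine Finset.sum_le_sum fun k hk => ?_
    rw [Finset.mem_Ico] at hk
    have h1 := hX.le_real_skipped hξ hp (hK.trans hk.1) (hq (k - 2) (by omega))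
      (by filter_upwards [h0] with ω hω using by omega)
    have h2 := one_le_log (hK.trans hk.1)
    calc _ = 1 / Real.log k * (P.real Set.univ / (D ξ k).toReal) / 28 := by rw [critReal]; ring
      _ ≤ 1 / Real.log k * (28 * P.real {ω | k ∈ skipped X ω}) / 28 := by gcongr
      _ = _ := by ring
  · rw [hX.integral_weightedCount_sq]
    refine (hX.sum_sum_real_skipped_le hξ hp hU hK h0 hD hlog n).trans ?_
    have hM : 0 ≤ P.real Set.univ := measureReal_nonneg
    rw [mul_comm 2, mul_assoc]
    refine mul_le_mul_of_nonneg_left ?_ hM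
    -- From `hS`, 13 S ≤ S ^ 2.
    nlinarith

end Moments

theorem measurableSet_infinite_skipped (hX : ∀ k, Measurable (X k)) :
    MeasurableSet {ω | (skipped X ω).Infinite} := by
  have : {ω | (skipped X ω).Infinite} = ⋂ n, ⋃ k ∈ Set.Ioi n, {ω | k ∈ skipped X ω} := by
    ext ω
    simp only [Set.mem_ofPred_eq, Set.infinite_iff_exists_gt, Set.mem_iInter, Set.mem_iUnion,
      Set.mem_Ioi, exists_prop]
    exact forall_congr' fun n => exists_congr fun k => and_comm
  rw [this]
  exact MeasurableSet.iInter fun n => MeasurableSet.biUnion (Set.to_countable _) fun k _ =>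
    (measurable_pi_lambda _ hX) (measurableSet_forall_ne k)

theorem tendsto_sum_critReal {K : ℕ} (hK : 4 ≤ K) (hD : ∀ k, K ≤ k → D ξ k ≠ ∞)
    (hcrit : critSum ξ = ∞) :
    Tendsto (fun n => ∑ k ∈ Finset.Ico K (K + n), critReal ξ k) atTop atTop := by
  have h1 : ∀ n, ∑ k ∈ Finset.Ico K (K + n), critReal ξ k =
      ∑ i ∈ Finset.range n, critReal ξ (K + i) := fun n => by
    rw [Finset.sum_Ico_eq_sum_range, Nat.add_sub_cancel_left]
  simp_rw [h1]
  rw [← not_summable_iff_tendsto_nat_atTop_of_nonneg fun i => critReal_nonneg ξ (by omega)]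
  intro hsum
  have hterm : ∀ i, critTerm ξ (K + i) = ENNReal.ofReal (critReal ξ (K + i)) := by
    intro i
    have hl := one_le_log (show 4 ≤ K + i by omega)
    have hd := one_le_toReal_D (hD (K + i) (by omega))
    rw [critTerm, critReal, one_div_mul_one_div_rev, one_div, one_div,
      ENNReal.ofReal_inv_of_pos (mul_pos (by linarith) (by linarith)),
      ENNReal.ofReal_mul (by linarith), ENNReal.ofReal_toReal (hD (K + i) (by omega))]
  have htail : ∑' i, critTerm ξ (K + i) ≠ ∞ := by
    simp_rw [hterm]
    exact hsum.tsum_ofReal_ne_top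
  have hsplit : ∑ i ∈ Finset.range (K - 2), critTerm ξ (i + 2) +
      ∑' i, critTerm ξ (i + (K - 2) + 2) = critSum ξ :=
    Summable.sum_add_tsum_nat_add' (f := fun i => critTerm ξ (i + 2)) ENNReal.summable
  rw [hcrit] at hsplit
  have e : ∀ i, i + (K - 2) + 2 = K + i := fun i => by omega
  simp_rw [e] at hsplit
  refine ENNReal.add_ne_top.2 ⟨?_, htail⟩ hsplit
  refine ENNReal.sum_ne_top.2 fun i _ => ?_
  rw [critTerm]
  refine ENNReal.div_ne_top ENNReal.one_ne_top (mul_ne_zero ?_ ?_)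
  · exact (lt_of_lt_of_le zero_lt_one (one_le_D ξ _)).ne'
  · rw [Ne, ENNReal.ofReal_eq_zero, not_le]
    refine Real.log_pos ?_
    push_cast
    have : (0 : ℝ) ≤ i := Nat.cast_nonneg i
    linarith

theorem weightedCount_le_of_finite {Ω : Type*} {X : ℕ → Ω → ℕ} {ω : Ω}
    (h : (skipped X ω).Finite) {K : ℕ} (hK : 4 ≤ K) (n : ℕ) :
    weightedCount X K n ω ≤ h.toFinset.card := by
  classical
  rw [weightedCount]
  calc _ ≤ ∑ k ∈ Finset.Ico K n, if k ∈ h.toFinset then (1 : ℝ) else 0 := by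
        refine Finset.sum_le_sum fun k hk => ?_
        have h1 := one_le_log (hK.trans (Finset.mem_Ico.1 hk).1)
        by_cases hs : k ∈ skipped X ω
        · rw [Set.indicator_of_mem (by exact hs), if_pos (by simpa using hs)]
          rw [div_le_one (by linarith)]
          exact h1
        · rw [Set.indicator_of_notMem (by exact hs), if_neg (by simpa using hs)]
    _ = ((Finset.Ico K n).filter (· ∈ h.toFinset)).card := by rw [Finset.sum_boole]
    _ ≤ _ := by
        gcongr
        exact fun k hk => (Finset.mem_filter.1 hk).2

/-- The events of `measureReal_weightedCount_ge` have mass bounded below for all large n, hence so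
has their limsup. On it the weighted counts are unbounded, and as the weights are at most 1 the
skipped set is infinite. -/
theorem IsWalk.le_measureReal_infinite_of_start [IsFiniteMeasure P] (hX : IsWalk P p X)
    (hξ : IsTailSolution p ξ) (hp : ∀ n, 1 ≤ n → 1 / 3 ≤ p n ∧ p n < 1)
    (hU : ∀ n, 1 ≤ n → 1 / ξ n ≤ 1) {K : ℕ} (hK : 4 ≤ K) (hq : ∀ n, K ≤ n + 2 → p n ≤ 2 / 3)
    (h0 : ∀ᵐ ω ∂P, X 0 ω < K) (hD : ∀ k, K ≤ k → D ξ k ≠ ∞)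
    (hlog : ∀ k, K ≤ k → Real.log (D ξ k).toReal ≤ 3 * Real.log k) (hcrit : critSum ξ = ∞) :
    P.real Set.univ / 3136 ≤ P.real {ω | (skipped X ω).Infinite} := by
  set S : ℕ → ℝ := fun n => ∑ k ∈ Finset.Ico K (K + n), critReal ξ k
  have hS : Tendsto S atTop atTop := tendsto_sum_critReal hK hD hcrit
  set B : ℕ → Set Ω := fun n => {ω | S n / 112 ≤ weightedCount X K (K + n) ω}
  have hBm : ∀ n, MeasurableSet (B n) := fun n =>
    measurableSet_le measurable_const (hX.measurable_weightedCount K (K + n))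
  obtain ⟨n₁, hn₁⟩ := eventually_atTop.1 (hS.eventually_ge_atTop 13)
  set T : ℕ → Set Ω := fun N => ⋃ n ∈ Set.Ici N, B n
  have hT : ∀ N, P.real Set.univ / 3136 ≤ P.real (T N) := by
    intro N
    refine (hX.measureReal_weightedCount_ge hξ hp hU hK hq h0 hD hlog
      (hn₁ (max N n₁) (le_max_right _ _))).trans (measureReal_mono ?_ (measure_ne_top _ _))
    exact Set.subset_biUnion_of_mem (u := B) (Set.mem_Ici.2 (le_max_left N n₁))
  have hlim : Tendsto (fun N => P.real (T N)) atTop (𝓝 (P.real (⋂ N, T N))) := by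
    refine (ENNReal.tendsto_toReal (measure_ne_top _ _)).comp (tendsto_measure_iInter_atTop
      (fun N => (MeasurableSet.biUnion (Set.to_countable _) fun n _ => hBm n).nullMeasurableSet) ?_
      ⟨0, measure_ne_top _ _⟩)
    exact fun a b hab => Set.biUnion_subset_biUnion_left fun n hn => le_trans hab hn
  refine (ge_of_tendsto' hlim hT).trans (measureReal_mono ?_)
  intro ω hω hfin
  have hfin' : (skipped X ω).Finite := hfin
  obtain ⟨N, hN⟩ := eventually_atTop.1
    (hS.eventually_gt_atTop (112 * (hfin'.toFinset.card : ℝ)))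
  obtain ⟨n, hn, hB⟩ := Set.mem_iUnion₂.1 (Set.mem_iInter.1 hω N)
  have h1 := hN n hn
  have h2 : S n / 112 ≤ weightedCount X K (K + n) ω := hB
  have h3 := weightedCount_le_of_finite hfin' hK (K + n)
  linarith

/-- Only finitely many sites are visited before time t. -/
theorem infinite_skipped_of_shift {Ω : Type*} {X : ℕ → Ω → ℕ} {ω : Ω} (t : ℕ)
    (h : (skipped (fun i => X (t + i)) ω).Infinite) : (skipped X ω).Infinite := by
  have hfin : ((fun i => X i ω) '' Set.Iio t).Finite := (Set.finite_Iio t).image _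
  refine (h.sdiff hfin).mono ?_
  rintro k ⟨h1, h2⟩ n hn
  rcases Nat.lt_or_ge n t with hnt | hnt
  · exact h2 ⟨n, hnt, hn⟩
  · have := h1 (n - t)
    simp only [show t + (n - t) = n by omega] at this
    exact this hn

/-- The filtration of the first coordinates. -/
def initialFiltration (X : ℕ → Ω → ℕ) (hX : ∀ k, Measurable (X k)) :
    Filtration ℕ (inferInstance : MeasurableSpace Ω) where
  seq t := MeasurableSpace.comap (initial X t) ⊤
  mono' s t hst := by
    rintro _ ⟨B, -, rfl⟩
    exact ⟨(fun y (i : Fin (s + 1)) => y ⟨i, by omega⟩) ⁻¹' B, trivial, rfl⟩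
  le' t := by
    rintro _ ⟨B, -, rfl⟩
    refine Past.measurableSet hX (t := t) fun ω ω' e hω => ?_
    have : initial X t ω = initial X t ω' := funext fun i => e i (by omega)
    change initial X t ω' ∈ B
    rw [← this]
    exact hω

/-- An event that has conditional probability at least `c > 0` given each past has full measure. -/
theorem ae_of_past_le [IsFiniteMeasure P] (hX : ∀ k, Measurable (X k)) {A : Set Ω}
    (hA : MeasurableSet[⨆ t, (initialFiltration X hX) t] A) {c : ℝ} (hc : 0 < c)
    (h : ∀ t C, Past X t C → c * P.real C ≤ P.real (C ∩ A)) : ∀ᵐ ω ∂P, ω ∈ A := by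
  set ℱ := initialFiltration X hX
  have hle : (⨆ t, ℱ t) ≤ (inferInstance : MeasurableSpace Ω) := iSup_le fun t => ℱ.le t
  have hA' : MeasurableSet A := hle _ hA
  set g : Ω → ℝ := A.indicator fun _ => 1 with hg
  have hgi : Integrable g P := (integrable_const _).indicator hA'
  have hgm : StronglyMeasurable[⨆ t, ℱ t] g := stronglyMeasurable_const.indicator hA
  -- Lévy's upward theorem: the conditional probabilities of `A` converge almost surely to its
  -- indicator, so a uniform lower bound c > 0 forces the indicator to be 1.
  have hlim := tendsto_ae_condExp (μ := P) (ℱ := ℱ) g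
  rw [condExp_of_stronglyMeasurable hle hgm hgi] at hlim
  have hge : ∀ t, ∀ᵐ ω ∂P, c ≤ (P[g | ℱ t]) ω := by
    intro t
    set f := P[g | ℱ t]
    have hfm : StronglyMeasurable[ℱ t] f := stronglyMeasurable_condExp
    set C : Set Ω := {ω | f ω < c} with hC
    have hCm : MeasurableSet[ℱ t] C := hfm.measurable measurableSet_Iio
    have hCm' : MeasurableSet C := ℱ.le t _ hCm
    have hCp : Past X t C := by
      obtain ⟨B, -, hB⟩ := hCm
      rw [← hB]
      intro ω ω' e hω
      have : initial X t ω = initial X t ω' := funext fun i => e i (by omega)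
      change initial X t ω' ∈ B
      rw [← this]
      exact hω
    have hfi : Integrable f P := integrable_condExp
    have hint : ∫ ω in C, f ω ∂P = P.real (C ∩ A) := by
      rw [setIntegral_condExp (ℱ.le t) hgi hCm, hg, setIntegral_indicator hA', setIntegral_const,
        smul_eq_mul, mul_one]
    have hsub : ∫ ω in C, (c - f ω) ∂P ≤ 0 := by
      rw [integral_sub (integrable_const _) hfi.integrableOn, setIntegral_const, hint, smul_eq_mul]
      linarith [h t C hCp]
    have hnn : 0 ≤ᵐ[P.restrict C] fun ω => c - f ω := by
      refine (ae_restrict_iff' hCm').2 (Eventually.of_forall fun ω hω => ?_)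
      have : f ω < c := hω
      change 0 ≤ c - f ω
      linarith
    -- The set where the conditional probability is below c is itself an event of the past; `h`
    -- applied to it leaves a nonnegative integrand with nonpositive integral.
    have hzero : ∫ ω in C, (c - f ω) ∂P = 0 :=
      le_antisymm hsub (integral_nonneg_of_ae hnn)
    rw [setIntegral_eq_zero_iff_of_nonneg_ae hnn
      ((integrable_const _).sub hfi).integrableOn] at hzero
    have hz := (ae_restrict_iff' hCm').1 hzero
    filter_upwards [hz] with ω hω
    by_contra hlt
    have h1 : f ω < c := not_le.1 hlt
    have h2 : c - f ω = 0 := hω h1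
    linarith
  filter_upwards [hlim, ae_all_iff.2 hge] with ω h1 h2
  have h3 : c ≤ g ω := ge_of_tendsto' h1 h2
  by_contra hω
  rw [hg, Set.indicator_of_notMem hω] at h3
  linarith

theorem measurableSet_iSup_infinite_skipped (hX : ∀ k, Measurable (X k)) :
    MeasurableSet[⨆ t, (initialFiltration X hX) t] {ω | (skipped X ω).Infinite} := by
  refine @measurableSet_infinite_skipped Ω (⨆ t, (initialFiltration X hX) t) X fun k => ?_
  intro B _
  refine (le_iSup (fun t => (initialFiltration X hX) t) k) _ ?_
  exact ⟨{y | y (Fin.last k) ∈ B}, trivial, rfl⟩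

/-- If `critSum ξ` is infinite and `D` grows at most like `n ^ 3`, almost surely there are infinitely
many skipped points. -/
theorem IsWalk.ae_infinite_skipped [IsFiniteMeasure P] (hX : IsWalk P p X)
    (hξ : IsTailSolution p ξ) (hp : ∀ n, 1 ≤ n → 1 / 3 ≤ p n ∧ p n < 1)
    (hU : ∀ n, 1 ≤ n → 1 / ξ n ≤ 1) (hq : ∀ᶠ n in atTop, p n ≤ 2 / 3)
    (hD : ∀ᶠ n in atTop, D ξ n ≠ ∞)
    (hlog : ∀ᶠ n : ℕ in atTop, Real.log (D ξ n).toReal ≤ 3 * Real.log n)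
    (hcrit : critSum ξ = ∞) : ∀ᵐ ω ∂P, (skipped X ω).Infinite := by
  obtain ⟨N, hN⟩ := eventually_atTop.1 (hq.and (hD.and hlog))
  have hA' := measurableSet_infinite_skipped hX.measurable
  refine ae_of_past_le (A := {ω | (skipped X ω).Infinite}) hX.measurable
    (measurableSet_iSup_infinite_skipped hX.measurable)
    (c := 1 / 3136) (by norm_num) fun t C hC => ?_
  -- The threshold K depends on the current position a, but the constant 3136 does not, so the
  -- bounds can be summed over a.
  have key : ∀ a, P (C ∩ X t ⁻¹' {a}) ≤
      3136 * P (C ∩ {ω | (skipped X ω).Infinite} ∩ X t ⁻¹' {a}) := by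
    intro a
    have hC' : Past X t (C ∩ X t ⁻¹' {a}) := hC.inter (past_preimage X le_rfl {a})
    have hm := hC'.measurableSet hX.measurable
    have hw := hX.shift hC'
    have hx : ∀ᵐ ω ∂(P.restrict (C ∩ X t ⁻¹' {a})), X (t + 0) ω < N + a + 4 := by
      rw [ae_restrict_iff' hm]
      refine Eventually.of_forall fun ω hω => ?_
      have : X t ω = a := hω.2
      rw [add_zero, this]
      omega
    have h1 := hw.le_measureReal_infinite_of_start hξ hp hU (K := N + a + 4) (by omega)
      (fun n hn => (hN n (by omega)).1) hx (fun k hk => (hN k (by omega)).2.1)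
      (fun k hk => (hN k (by omega)).2.2) hcrit
    have h2 : (P.restrict (C ∩ X t ⁻¹' {a})).real Set.univ ≤
        3136 * (P.restrict (C ∩ X t ⁻¹' {a})).real {ω | (skipped X ω).Infinite} := by
      have := measureReal_mono (μ := P.restrict (C ∩ X t ⁻¹' {a}))
        (show {ω | (skipped (fun i => X (t + i)) ω).Infinite} ⊆ {ω | (skipped X ω).Infinite} from
          fun ω hω => infinite_skipped_of_shift t hω)
      linarith
    rw [measureReal_restrict_apply .univ, Set.univ_inter, measureReal_restrict_apply hA',
      measureReal_def, measureReal_def] at h2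
    rw [← ENNReal.toReal_le_toReal (measure_ne_top _ _)
      (ENNReal.mul_ne_top (by norm_num) (measure_ne_top _ _)), ENNReal.toReal_mul]
    rw [Set.inter_right_comm, Set.inter_comm (C ∩ X t ⁻¹' {a})]
    simpa using h2
  have hsum : P C ≤ 3136 * P (C ∩ {ω | (skipped X ω).Infinite}) := by
    have hf : ∀ i, MeasurableSet (X t ⁻¹' {i}) := fun i =>
      hX.measurable t (measurableSet_singleton i)
    rw [measure_eq_tsum_fiber P (X t) hf C, measure_eq_tsum_fiber P (X t) hf (C ∩ _),
      ← ENNReal.tsum_mul_left]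
    exact ENNReal.tsum_le_tsum key
  have := ENNReal.toReal_mono (ENNReal.mul_ne_top (by norm_num) (measure_ne_top _ _)) hsum
  rw [ENNReal.toReal_mul, ← measureReal_def, ← measureReal_def] at this
  rw [ENNReal.toReal_ofNat] at this
  linarith

end SkipWalk

/-! ### Conclusion. -/

namespace SkipWalk

theorem ratio_pos {p : ℕ → ℝ} {n : ℕ} (h : 1 / 3 ≤ p n ∧ p n < 1) : 0 < ratio p n :=
  div_pos (by linarith) (by linarith)

theorem ratio_le_two {p : ℕ → ℝ} {n : ℕ} (h : 1 / 3 ≤ p n ∧ p n < 1) : ratio p n ≤ 2 := by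
  rw [ratio, div_le_iff₀ (by linarith)]
  linarith

theorem ratio_le_ratio {p : ℕ → ℝ} {m n : ℕ} (hm : p m < 1) (hn : 0 < p n) (h : p n ≤ p m) :
    ratio p m ≤ ratio p n :=
  div_le_div₀ (by linarith) (by linarith) hn h

/-- Once n ≥ δ, the bounds δ ≤ n and log n ≤ n give D(n) ≤ n ^ 3; only this polynomial growth enters
the second moment. -/
theorem log_toReal_D_le {ξ : ℕ → ℝ} {δ : ℝ} {n : ℕ} (hδ : δ ≤ n) (hn : 1 ≤ n)
    (h : D ξ n ≤ ENNReal.ofReal (δ * n * Real.log n)) :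
    Real.log (D ξ n).toReal ≤ 3 * Real.log n := by
  have hn' : (1 : ℝ) ≤ n := by exact_mod_cast hn
  have hlog0 : 0 ≤ Real.log n := Real.log_nonneg hn'
  have hlog : Real.log n ≤ n := (Real.log_le_sub_one_of_pos (by linarith)).trans (by linarith)
  have h1 : δ * n * Real.log n ≤ (n : ℝ) ^ 3 := by
    calc δ * n * Real.log n ≤ n * n * n := by gcongr
      _ = (n : ℝ) ^ 3 := by ring
  have hD := one_le_toReal_D (ne_top_of_le_ne_top ENNReal.ofReal_ne_top h)
  have h2 : (D ξ n).toReal ≤ (n : ℝ) ^ 3 :=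
    ENNReal.toReal_le_of_le_ofReal (by positivity) (h.trans (ENNReal.ofReal_le_ofReal h1))
  have h3 := Real.log_le_log (by linarith) h2
  rwa [Real.log_pow] at h3

end SkipWalk

theorem theorem1p1 {Ω : Type*} [MeasurableSpace Ω] (P : Measure Ω) [IsProbabilityMeasure P]
    (r : ℕ → ℝ)
    (hr_range : ∀ n, 1 ≤ n → 0 ≤ r n ∧ r n < 2 / 3)
    (hr_anti : ∀ n, 1 ≤ n → r (n + 1) ≤ r n)
    (hr_lim : Tendsto r atTop (𝓝 0))
    (hr_diff : (fun n => r n - r (n + 1)) =O[atTop] (fun n => r n ^ 2))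
    (X : ℕ → Ω → ℕ) (hX : SkipWalk.IsWalk P (fun n => 1 / 3 + r n) X)
    (ξ : ℕ → ℝ) (hξ : SkipWalk.IsTailSolution (fun n => 1 / 3 + r n) ξ) :
    (SkipWalk.critSum ξ < ∞ → ∀ᵐ ω ∂P, (SkipWalk.skipped X ω).Finite) ∧
    ((∃ δ : ℝ, 0 < δ ∧
        ∀ᶠ n : ℕ in atTop, SkipWalk.D ξ n ≤ ENNReal.ofReal (δ * n * Real.log n)) →
      SkipWalk.critSum ξ = ∞ →
      11 / 27 ≤ P {ω | (SkipWalk.skipped X ω).Infinite}) := by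
  have hp : ∀ n, 1 ≤ n → 1 / 3 ≤ (fun n => 1 / 3 + r n) n ∧ (fun n => 1 / 3 + r n) n < 1 := by
    intro n hn
    have := hr_range n hn
    exact ⟨by linarith, by linarith⟩
  have hU : ∀ n, 1 ≤ n → 1 / ξ n ≤ 1 := fun n hn =>
    hξ.one_div_le_one (fun n hn => SkipWalk.ratio_pos (hp n hn))
      (fun n hn => SkipWalk.ratio_le_ratio (hp n hn).2
        (by linarith [(hp (n + 1) (by omega)).1]) (by linarith [hr_anti n hn]))
      (fun n hn => SkipWalk.ratio_le_two (hp n hn)) hn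
  have hq : ∀ᶠ n in atTop, (fun n => 1 / 3 + r n) n ≤ 2 / 3 := by
    filter_upwards [hr_lim.eventually_le_const (show (0 : ℝ) < 1 / 3 by norm_num)] with n hn
    linarith
  refine ⟨fun hcrit => hX.ae_finite_skipped hξ hp hU hq hcrit, ?_⟩
  rintro ⟨δ, -, hδ⟩ hcrit
  have hinf := hX.ae_infinite_skipped hξ hp hU hq
    (hδ.mono fun n hn => ne_top_of_le_ne_top ENNReal.ofReal_ne_top hn)
    (by
      filter_upwards [hδ, eventually_ge_atTop 1, tendsto_natCast_atTop_atTop.eventually_ge_atTop δ]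
        with n h1 h2 h3 using SkipWalk.log_toReal_D_le h3 h2 h1) hcrit
  -- The probability is 1, and 11/27 ≤ 1.
  rw [(prob_compl_eq_zero_iff
    (SkipWalk.measurableSet_infinite_skipped hX.measurable)).1 hinf]
  exact ENNReal.div_le_of_le_mul (by norm_num)
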